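/- \textbf{Setting.} A line network has $L\ge 2$ links in tandem, with pairwise distinct parameters $p_1,\dots,p_L\in(0,1]$. In every time slot each non-sink node sends one packet over its outgoing link (deterministic regular transmissions); a packet sent over link $i$ is received with probability $p_i$ (Bernoulli losses). Put $p=\min_{1\le i\le L}p_i$ and $\gamma_e=\min_{1<i\le L}|p_i-p_{i-1}|$. In a chunked code with precoding (CCP), a precode maps the $k$ message vectors, which lie in a vector space over $\mathbb F_2$, to $q\alpha$ intermediate packets, arranged in $q$ chunks of size $\alpha$. The precode corrects a fraction $\delta$ of erasures if the message is determined by the intermediate packets outside any set of at most $\delta q\alpha$ of them. For every transmission the sending node picks one of the $q$ chunks uniformly at random. The source then sends a uniformly random $\mathbb F_2$-linear combination of the $\alpha$ packets of that chunk, and any other node sends a uniformly random $\mathbb F_2$-linear combination of the packets of that chunk that it received in earlier slots. All random choices and losses are independent. The sink decodes a chunk once the global encoding vectors of the packets it has received from that chunk span $\mathbb F_2^\alpha$. The coding delay is the least number of slots after which the intermediate packets in the decoded chunks determine the message. \textbf{Theorem.} There is an absolute constant $C>0$, and for every $\delta_0\in(0,1)$ there is a constant $K=K(\delta_0)>0$,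 such that the following holds. Let a line network as above be given, and let $\gamma_a,\gamma_b,\gamma_c\in(0,1)$ be constants with $(1+\gamma_a)\gamma_b\le\delta_0$. Consider a sequence of CCPs with message size $k\to\infty$, chunk size $\alpha$ and $q\ge1$ chunks ($\alpha$ and $q$ may vary along the sequence), whose precodes correct a fraction $(1+\gamma_a)\gamma_b$ of erasures and have rate $k/(q\alpha)\to 1-(1+\gamma_a)\gamma_b$, together with a sequence of numbers $\epsilon\in(0,1)$. Suppose that, for all large $k$ along the sequence, $$\alpha\ \ge\ C\max\left\{\frac{L}{\gamma_c^3}\log\frac{L}{\gamma_b\gamma_c},\ \frac{L}{\gamma_e^3}\log\frac{L}{\gamma_e\gamma_b}\right\},$$ and that $$\frac{\alpha^2}{\gamma_a^2\gamma_b^2}=o\!\left(\frac{k}{\log(1/\epsilon)}\right)\qquad(k\to\infty).$$ Then, for all large $k$ along the sequence, the coding delay is larger than $$(1+\gamma_c)\left(1+(1+\gamma_a)\gamma_b+K\gamma_b^2\right)\frac kp$$ with probability at most $\epsilon$. -/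

import Mathlib

open MeasureTheory ProbabilityTheory Filter Asymptotics Topology
open scoped ENNReal

noncomputable section

namespace ChunkedCode

/-- A line network of `L` links in tandem. In each time slot there is one transmission over every
link (deterministic regular transmissions), and a transmission over link `i` succeeds with
probability `p i` (Bernoulli losses). Links are numbered from `0`; link `i` goes from node `i` to
node `i + 1`, node `0` is the source and node `L` is the sink. -/
structure LineNetwork (L : ℕ) where
  p : Fin L → ℝ
  p_pos : ∀ i, 0 < p i
  p_le_one : ∀ i, p i ≤ 1

namespace LineNetwork

variable {L : ℕ}

/-- The smallest success parameter of the links. -/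
def minP (N : LineNetwork L) : ℝ := ⨅ i, N.p i

/-- The smallest difference, in absolute value, of the parameters of two consecutive links. -/
def minGap (N : LineNetwork L) : ℝ :=
  ⨅ i : Fin (L - 1), |N.p ⟨i.1 + 1, by have := i.2; omega⟩ - N.p ⟨i.1, by have := i.2; omega⟩|

end LineNetwork

/-- The random data of one transmission of a chunked code with `q` chunks: whether it succeeds, the
chunk that the sending node picks, and the random coefficients in `𝔽₂` of the linear combination
that the node forms. -/
abbrev Slot (q : ℕ) : Type := Bool × Fin q × (ℕ → ZMod 2)

/-- All the random data: one `Slot` for every link and every time slot. -/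
abbrev Outcome (L q : ℕ) : Type := Fin L × ℕ → Slot q

/-- The law of one transmission with success probability `r`: the success bit is Bernoulli, the
chunk is uniform, the coefficients are i.i.d. uniform, and the three are independent. -/
def slotLaw (q : ℕ) (r : unitInterval) : Measure (Slot q) :=
  (bernoulliMeasure true false r).prod
    ((uniformOn (Set.univ : Set (Fin q))).prod
      (Measure.infinitePi fun _ : ℕ => uniformOn (Set.univ : Set (ZMod 2))))

/-- The joint law of the code and of the traffic: all transmissions are independent. -/
def law {L : ℕ} (N : LineNetwork L) (q : ℕ) : Measure (Outcome L q) :=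
  Measure.infinitePi fun x : Fin L × ℕ => slotLaw q ⟨N.p x.1, (N.p_pos x.1).le, N.p_le_one x.1⟩

section

variable {L q : ℕ}

/-- The transmission over link `i` in slot `t` succeeds. -/
def success (ω : Outcome L q) (i : Fin L) (t : ℕ) : Prop := (ω (i, t)).1 = true

/-- The chunk to which the packet sent over link `i` in slot `t` pertains. -/
def chunk (ω : Outcome L q) (i : Fin L) (t : ℕ) : Fin q := (ω (i, t)).2.1

/-- The random coefficients used for the packet sent over link `i` in slot `t`. -/
def coeff (ω : Outcome L q) (i : Fin L) (t : ℕ) : ℕ → ZMod 2 := (ω (i, t)).2.2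

open Classical in
/-- The global encoding vector of the packet sent over link `i` in slot `t`, with respect to the `α`
packets of the chunk `chunk ω i t`. The source combines all packets of the chunk; any other node
combines all packets of the chunk that it has received in earlier slots (this is the zero vector if
there are none). -/
def globalVector (α : ℕ) (ω : Outcome L q) : (i : ℕ) → i < L → ℕ → (Fin α → ZMod 2)
  | 0, h, t => fun m => coeff ω ⟨0, h⟩ t m
  | i + 1, h, t =>
      ∑ s ∈ Finset.range t,
        if success ω ⟨i, by omega⟩ s ∧ chunk ω ⟨i, by omega⟩ s = chunk ω ⟨i + 1, h⟩ t then
          coeff ω ⟨i + 1, h⟩ t s • globalVector α ω i (by omega) s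
        else 0

/-- Chunk `c`, of `α` packets, is decodable at the sink after the first `T` time slots: the global
encoding vectors of the packets of this chunk received over the last link span `𝔽₂ ^ α`. -/
def ChunkDecodable (α : ℕ) (ω : Outcome L q) (T : ℕ) (c : Fin q) : Prop :=
  ∃ i : Fin L, i.1 + 1 = L ∧
    Submodule.span (ZMod 2)
      {v | ∃ t < T, success ω i t ∧ chunk ω i t = c ∧ v = globalVector α ω i.1 i.2 t} = ⊤

variable {k α : ℕ} {F : Type*}

/-- A precode maps the `k` message vectors to `q * α` intermediate packets, arranged in `q` chunks
of size `α`. It corrects a fraction `δ` of erasures if the message is determined by the intermediate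
packets outside any set of at most `δ * (q * α)` erased ones. -/
def CorrectsErasures (encode : (Fin k → F) → (Fin q × Fin α → F)) (δ : ℝ) : Prop :=
  ∀ E : Finset (Fin q × Fin α), (E.card : ℝ) ≤ δ * ((q : ℝ) * α) →
    ∀ u v : Fin k → F, (∀ x ∉ E, encode u x = encode v x) → u = v

/-- After the first `T` time slots the sink can recover all message vectors: the intermediate
packets in the decodable chunks determine the message. -/
def MessageRecovered (encode : (Fin k → F) → (Fin q × Fin α → F)) (ω : Outcome L q) (T : ℕ) :
    Prop :=
  ∀ u v : Fin k → F,
    (∀ c, ChunkDecodable α ω T c → ∀ m, encode u (c, m) = encode v (c, m)) → u = v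

/-- The coding delay of the chunked code with precoding: the least number of time slots after which
the sink can recover all message vectors (`∞` if it never can). -/
def codingDelay (encode : (Fin k → F) → (Fin q × Fin α → F)) (ω : Outcome L q) : ℝ≥0∞ :=
  ⨅ (T : ℕ) (_ : MessageRecovered encode ω T), (T : ℝ≥0∞)

end

instance isProbabilityMeasure_slotLaw (q : ℕ) [NeZero q] (r : unitInterval) :
    IsProbabilityMeasure (slotLaw q r) := by
  have h1 : IsProbabilityMeasure (uniformOn (Set.univ : Set (Fin q))) :=
    isProbabilityMeasure_uniformOn Set.finite_univ Set.univ_nonempty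
  have h2 : IsProbabilityMeasure (uniformOn (Set.univ : Set (ZMod 2))) :=
    isProbabilityMeasure_uniformOn Set.finite_univ Set.univ_nonempty
  unfold slotLaw
  infer_instance

instance isProbabilityMeasure_law {L : ℕ} (N : LineNetwork L) (q : ℕ) [NeZero q] :
    IsProbabilityMeasure (law N q) := by
  unfold law
  infer_instance

end ChunkedCode

end

/-! Fix the slot `T` at which the claimed delay ends and count the undecodable chunks. The precode
tolerates a fraction `(1 + γa) * γb` of failed chunks. It therefore suffices that each chunk fails
with probability at most `γb`, and that the number of failures exceeds its mean by `γa * γb * q`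
with probability at most `ε`.

Concentration is McDiarmid's inequality (`expect_indicator_ge_le`). The data of one transmission
affect only the chunk it picks, so resampling them changes the count by at most 2. The exponent is
of order `(γa * γb * q)² / (L * T)`. Since `q ≥ k / α` and `T` is of order `k`, the little-o
hypothesis makes it exceed `log (1/ε)`.

For a single chunk, failure means that some nonzero `u` is orthogonal to every vector the sink
received. Fix `u` and follow a frontier, a node able to send vectors not orthogonal to `u`. Whenever
a packet of the chunk arrives over the link leaving the frontier, one uniform bit decides whether
its vector is orthogonal to `u`, so the frontier advances with probability 1/2. Flipping that bit is
a weight-preserving involution that fixes losses and chunk choices (`hit_flip`,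
`sum_mul_raceFailure_succ`). Given the schedule, survival of `u` is thus bounded by a race of a
token driven by fair coins.

Cut time into `w` windows, with at least `n` arrivals per link in each. The token stays put through
a window with probability at most `2⁻ⁿ`, and a losing token does so in at least `w + 1 - L` windows,
giving `2 ^ w * 2 ^ (-n (w + 1 - L))` (`raceFailure_windows_le`). With `w` about `8L/γ` and `n`
about `(1 + γ/2) α / w`, this beats the union bound over `2 ^ α` vectors `u`. Chernoff's bound shows
that the windows are full enough (`expect_undecodable_le_of_large`). -/

noncomputable section

namespace ChunkedCode

/-! ### Expectations over finite products and bounded differences. -/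

section Expectation

variable {ι S : Type*} [Fintype ι] [DecidableEq ι] [Fintype S]

/-- The expectation of `f` under the product of the weights `P i` on the finite type `S`. -/
def expect (P : ι → S → ℝ) (f : (ι → S) → ℝ) : ℝ := ∑ x, (∏ i, P i (x i)) * f x

theorem expect_mono {P : ι → S → ℝ} (hP : ∀ i s, 0 ≤ P i s) {f g : (ι → S) → ℝ}
    (h : ∀ x, f x ≤ g x) : expect P f ≤ expect P g :=
  Finset.sum_le_sum fun x _ =>
    mul_le_mul_of_nonneg_left (h x) (Finset.prod_nonneg fun i _ => hP i (x i))

theorem expect_sum (P : ι → S → ℝ) {κ : Type*} (s : Finset κ) (f : κ → (ι → S) → ℝ) :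
    expect P (fun x => ∑ j ∈ s, f j x) = ∑ j ∈ s, expect P (f j) := by
  simp only [expect, Finset.mul_sum]
  exact Finset.sum_comm

theorem expect_add (P : ι → S → ℝ) (f g : (ι → S) → ℝ) :
    expect P (fun x => f x + g x) = expect P f + expect P g := by
  simp only [expect, mul_add, Finset.sum_add_distrib]

theorem expect_const_mul (P : ι → S → ℝ) (a : ℝ) (f : (ι → S) → ℝ) :
    expect P (fun x => a * f x) = a * expect P f := by
  simp only [expect, Finset.mul_sum]
  exact Finset.sum_congr rfl fun x _ => by ring

theorem expect_prod (P : ι → S → ℝ) (g : ι → S → ℝ) :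
    expect P (fun x => ∏ i, g i (x i)) = ∏ i, ∑ s, P i s * g i s := by
  simp only [expect, ← Finset.prod_mul_distrib]
  rw [Finset.prod_univ_sum, Fintype.piFinset_univ]

theorem expect_const {P : ι → S → ℝ} (hP : ∀ i, ∑ s, P i s = 1) (a : ℝ) :
    expect P (fun _ => a) = a := by
  have h := expect_prod P (fun _ _ => 1)
  simp only [Finset.prod_const_one, mul_one, hP] at h
  have h2 := expect_const_mul P a (fun _ => 1)
  simpa [h] using h2

theorem expect_cons {n : ℕ} (P : Fin (n + 1) → S → ℝ) (f : (Fin (n + 1) → S) → ℝ) :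
    expect P f = ∑ s, P 0 s * expect (fun i : Fin n => P i.succ) (fun x => f (Fin.cons s x)) := by
  unfold expect
  rw [← (Fin.consEquiv (fun _ : Fin (n + 1) => S)).sum_comp, Fintype.sum_prod_type]
  refine Finset.sum_congr rfl fun s _ => ?_
  rw [Finset.mul_sum]
  refine Finset.sum_congr rfl fun x _ => ?_
  simp [Fin.consEquiv, Fin.prod_univ_succ, mul_assoc]

theorem expect_equiv {κ : Type*} [Fintype κ] [DecidableEq κ] (e : ι ≃ κ) (P : ι → S → ℝ)
    (f : (ι → S) → ℝ) :
    expect P f = expect (fun k => P (e.symm k)) (fun x => f (fun i => x (e i))) := by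
  unfold expect
  rw [← (Equiv.arrowCongr e (Equiv.refl S)).symm.sum_comp]
  refine Finset.sum_congr rfl fun x _ => ?_
  rw [← e.symm.prod_comp]
  simp [Equiv.arrowCongr, Function.comp_def]

/-- Hoeffding's lemma for a finitely supported law, by symmetrization. -/
theorem sum_mul_exp_sub_mean_le {P g : S → ℝ} (hP : ∀ s, 0 ≤ P s) (hP1 : ∑ s, P s = 1) {c : ℝ}
    (hg : ∀ s s', |g s - g s'| ≤ c) :
    ∑ s, P s * Real.exp (g s - ∑ s', P s' * g s') ≤ Real.exp (c ^ 2 / 2) := by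
  -- Jensen replaces the mean by an independent copy `s'`. Exchanging the two copies then turns
  -- `exp` into `cosh`. This gives `c² / 2` instead of the optimal `c² / 8`, which is enough here.
  have h1 : ∀ s, Real.exp (g s - ∑ s', P s' * g s') ≤ ∑ s', P s' * Real.exp (g s - g s') := by
    intro s
    have := convexOn_exp.map_sum_le (t := Finset.univ) (w := P) (p := fun s' => g s - g s')
      (fun i _ => hP i) hP1 (fun _ _ => Set.mem_univ _)
    simp only [smul_eq_mul, mul_sub, Finset.sum_sub_distrib, ← Finset.sum_mul, hP1, one_mul] at this
    exact this
  have h2 : ∑ s, P s * Real.exp (g s - ∑ s', P s' * g s')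
      ≤ ∑ s, ∑ s', P s * P s' * Real.exp (g s - g s') := by
    refine Finset.sum_le_sum fun s _ => (mul_le_mul_of_nonneg_left (h1 s) (hP s)).trans_eq ?_
    rw [Finset.mul_sum]
    exact Finset.sum_congr rfl fun s' _ => by ring
  have h3 : ∑ s, ∑ s', P s * P s' * Real.exp (g s - g s')
      = ∑ s, ∑ s', P s * P s' * Real.cosh (g s - g s') := by
    have h4 : ∑ s, ∑ s', P s * P s' * Real.exp (g s - g s')
        = ∑ s, ∑ s', P s * P s' * Real.exp (-(g s - g s')) := by
      rw [Finset.sum_comm]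
      exact Finset.sum_congr rfl fun s _ => Finset.sum_congr rfl fun s' _ => by
        rw [neg_sub, mul_comm (P s)]
    have h5 : ∑ s, ∑ s', P s * P s' * Real.cosh (g s - g s')
        = (∑ s, ∑ s', P s * P s' * Real.exp (g s - g s')
          + ∑ s, ∑ s', P s * P s' * Real.exp (-(g s - g s'))) / 2 := by
      rw [← Finset.sum_add_distrib, Finset.sum_div]
      refine Finset.sum_congr rfl fun s _ => ?_
      rw [← Finset.sum_add_distrib, Finset.sum_div]
      exact Finset.sum_congr rfl fun s' _ => by rw [Real.cosh_eq]; ring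
    rw [h5, ← h4]; ring
  have h6 : ∀ s s', Real.cosh (g s - g s') ≤ Real.exp (c ^ 2 / 2) := fun s s' =>
    (Real.cosh_le_exp_half_sq _).trans <| Real.exp_le_exp.2 <| by
      have := sq_le_sq' (neg_le_of_abs_le (hg s s')) (le_of_abs_le (hg s s'))
      linarith
  calc _ ≤ _ := h2
    _ = _ := h3
    _ ≤ ∑ s, ∑ s', P s * P s' * Real.exp (c ^ 2 / 2) :=
      Finset.sum_le_sum fun s _ => Finset.sum_le_sum fun s' _ =>
        mul_le_mul_of_nonneg_left (h6 s s') (mul_nonneg (hP s) (hP s'))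
    _ = _ := by simp only [← Finset.sum_mul, ← Finset.mul_sum, hP1, mul_one, one_mul]

/-- Coordinates are exposed one at a time. The conditional mean given the first coordinate still
oscillates by at most `c`, so Hoeffding's lemma handles it, and induction handles the fluctuation
around it. -/
theorem expect_exp_sub_fin_le {n : ℕ} {P : Fin n → S → ℝ} (hP : ∀ i s, 0 ≤ P i s)
    (hP1 : ∀ i, ∑ s, P i s = 1) {c : ℝ} {f : (Fin n → S) → ℝ}
    (hf : ∀ x i s, |f x - f (Function.update x i s)| ≤ c) :
    expect P (fun x => Real.exp (f x - expect P f)) ≤ Real.exp (n * (c ^ 2 / 2)) := by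
  induction n with
  | zero =>
    simp [expect]
  | succ n ih =>
    set Q : Fin n → S → ℝ := fun i => P i.succ with hQ
    set g : S → ℝ := fun s => expect Q (fun x => f (Fin.cons s x)) with hg
    have hmean : expect P f = ∑ s, P 0 s * g s := expect_cons P f
    have hgd : ∀ s s', |g s - g s'| ≤ c := by
      intro s s'
      have key : ∀ s s', g s ≤ g s' + c := by
        intro s s'
        have : g s ≤ expect Q (fun x => f (Fin.cons s' x) + c) := by
          refine expect_mono (fun i s => hP _ _) fun x => ?_
          have := hf (Fin.cons s x) 0 s'
          rw [Fin.update_cons_zero] at this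
          linarith [le_of_abs_le this]
        rwa [expect_add, expect_const (fun i => hP1 _)] at this
      rw [abs_le]
      constructor <;> linarith [key s s', key s' s]
    rw [expect_cons, hmean]
    have step : ∀ s, expect Q (fun x => Real.exp (f (Fin.cons s x) - ∑ s, P 0 s * g s))
        ≤ Real.exp (g s - ∑ s, P 0 s * g s) * Real.exp (n * (c ^ 2 / 2)) := by
      intro s
      have h := ih (P := Q) (fun i s => hP _ _) (fun i => hP1 _) (f := fun x => f (Fin.cons s x))
        (fun x i s' => by
          have := hf (Fin.cons s x) i.succ s'
          rwa [← Fin.cons_update] at this)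
      rw [show (fun x => Real.exp (f (Fin.cons s x) - ∑ s, P 0 s * g s))
        = fun x => Real.exp (g s - ∑ s, P 0 s * g s) * Real.exp (f (Fin.cons s x) - g s) from
        funext fun x => by rw [← Real.exp_add]; congr 1; ring, expect_const_mul]
      exact mul_le_mul_of_nonneg_left h (Real.exp_pos _).le
    calc _ ≤ ∑ s, P 0 s * (Real.exp (g s - ∑ s, P 0 s * g s) * Real.exp (n * (c ^ 2 / 2))) :=
          Finset.sum_le_sum fun s _ => mul_le_mul_of_nonneg_left (step s) (hP 0 s)
      _ = (∑ s, P 0 s * Real.exp (g s - ∑ s, P 0 s * g s)) * Real.exp (n * (c ^ 2 / 2)) := by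
          rw [Finset.sum_mul]
          exact Finset.sum_congr rfl fun s _ => by ring
      _ ≤ Real.exp (c ^ 2 / 2) * Real.exp (n * (c ^ 2 / 2)) :=
          mul_le_mul_of_nonneg_right (sum_mul_exp_sub_mean_le (hP 0) (hP1 0) hgd)
            (Real.exp_pos _).le
      _ = _ := by rw [← Real.exp_add]; congr 1; push_cast; ring

theorem expect_exp_sub_le {P : ι → S → ℝ} (hP : ∀ i s, 0 ≤ P i s)
    (hP1 : ∀ i, ∑ s, P i s = 1) {c : ℝ} {f : (ι → S) → ℝ}
    (hf : ∀ x i s, |f x - f (Function.update x i s)| ≤ c) :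
    expect P (fun x => Real.exp (f x - expect P f)) ≤ Real.exp (Fintype.card ι * (c ^ 2 / 2)) := by
  set e := Fintype.equivFin ι
  have h := expect_exp_sub_fin_le (P := fun k => P (e.symm k)) (f := fun x => f (fun i => x (e i)))
    (fun i s => hP _ _) (fun i => hP1 _) (c := c) ?_
  · rw [← expect_equiv e P f] at h
    rw [expect_equiv e]
    exact h
  intro x i s
  convert hf (fun j => x (e j)) (e.symm i) s using 4
  ext j
  by_cases h : e j = i
  · subst h; simp
  · rw [Function.update_of_ne h, Function.update_of_ne (fun h' => h (by simp [h']))]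

open Classical in
/-- McDiarmid's bounded differences inequality for finite products. -/
theorem expect_indicator_ge_le {P : ι → S → ℝ} (hP : ∀ i s, 0 ≤ P i s)
    (hP1 : ∀ i, ∑ s, P i s = 1) {c : ℝ} {f : (ι → S) → ℝ}
    (hf : ∀ x i s, |f x - f (Function.update x i s)| ≤ c) {m d : ℝ} (hm : expect P f ≤ m)
    (hd : 0 ≤ d) (hpos : 0 < Fintype.card ι * c ^ 2) :
    expect P (fun x => if m + d ≤ f x then 1 else 0)
      ≤ Real.exp (-(d ^ 2 / (2 * (Fintype.card ι * c ^ 2)))) := by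
  set N : ℝ := Fintype.card ι * c ^ 2 with hN
  -- The minimizer of the exponent `-l * d + l² * N / 2`.
  set l : ℝ := d / N with hl
  have hl0 : 0 ≤ l := by positivity
  have h := expect_exp_sub_le hP hP1 (c := l * c) (f := fun x => l * f x) (fun x i s => by
    rw [← mul_sub, abs_mul, abs_of_nonneg hl0]
    exact mul_le_mul_of_nonneg_left (hf x i s) hl0)
  rw [expect_const_mul] at h
  calc _ ≤ expect P (fun x => Real.exp (-(l * d)) * Real.exp (l * f x - l * expect P f)) := by
        refine expect_mono hP fun x => ?_
        rw [← Real.exp_add]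
        split_ifs with hx
        · apply Real.one_le_exp
          have : l * (m + d) ≤ l * f x := mul_le_mul_of_nonneg_left hx hl0
          have h2 : l * expect P f ≤ l * m := mul_le_mul_of_nonneg_left hm hl0
          linarith
        · positivity
    _ ≤ Real.exp (-(l * d)) * Real.exp (Fintype.card ι * ((l * c) ^ 2 / 2)) := by
        rw [expect_const_mul]
        exact mul_le_mul_of_nonneg_left h (Real.exp_pos _).le
    _ = _ := by
        rw [← Real.exp_add]
        congr 1
        rw [show (Fintype.card ι : ℝ) * ((l * c) ^ 2 / 2) = l ^ 2 * N / 2 by rw [hN]; ring, hl]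
        field_simp
        ring

end Expectation

/-! ### Reduction of the infinite product law to a finite one. -/

section Truncation

variable {L q T M : ℕ}

/-- The part of the random data of a transmission that matters when only `M` coefficients are
used. -/
abbrev FinSlot (M q : ℕ) : Type := Bool × Fin q × (Fin M → ZMod 2)

/-- The random data of the first `T` time slots, with `M` coefficients per transmission. -/
abbrev FinOutcome (L q T M : ℕ) : Type := Fin L × Fin T → FinSlot M q

/-- The probability of the data `s` of one transmission with success probability `r`. -/
def slotWeight (M q : ℕ) (r : ℝ) (s : FinSlot M q) : ℝ :=
  (if s.1 = true then r else 1 - r) * ((1 / q) * (1 / 2) ^ M)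

theorem slotWeight_nonneg {r : ℝ} (h0 : 0 ≤ r) (h1 : r ≤ 1) (s : FinSlot M q) :
    0 ≤ slotWeight M q r s := by
  unfold slotWeight
  have : 0 ≤ if s.1 = true then r else 1 - r := by split_ifs <;> linarith
  positivity

theorem sum_slotWeight_mul [NeZero q] (r : ℝ) (g : Bool → Fin q → ℝ) :
    ∑ s, slotWeight M q r s * g s.1 s.2.1
      = (r * ∑ c, g true c + (1 - r) * ∑ c, g false c) / q := by
  simp only [Fintype.sum_prod_type, Fintype.sum_bool, slotWeight, Finset.sum_const,
    Finset.card_univ, Fintype.card_fun, ZMod.card, Fintype.card_fin, nsmul_eq_mul, if_true,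
    Bool.false_eq_true, if_false]
  rw [Finset.mul_sum, Finset.mul_sum, add_div, Finset.sum_div, Finset.sum_div]
  have h : ((2 ^ M : ℕ) : ℝ) * (1 / 2) ^ M = 1 := by
    push_cast; rw [← mul_pow]; norm_num
  congr 1 <;> refine Finset.sum_congr rfl fun c _ => ?_
  · linear_combination (r * g true c / q) * h
  · linear_combination ((1 - r) * g false c / q) * h

theorem sum_slotWeight [NeZero q] (r : ℝ) : ∑ s, slotWeight M q r s = 1 := by
  have h := sum_slotWeight_mul (M := M) (q := q) r (fun _ _ => 1)
  have hq : (q : ℝ) ≠ 0 := Nat.cast_ne_zero.2 (NeZero.ne q)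
  simp only [mul_one, Finset.sum_const, Finset.card_univ, Fintype.card_fin, nsmul_eq_mul] at h
  rw [h]
  field_simp
  ring

/-- The first `T` time slots of an outcome, with `M` coefficients per transmission. -/
def truncate (T M : ℕ) (ω : Outcome L q) : FinOutcome L q T M := fun x =>
  ((ω (x.1, x.2)).1, (ω (x.1, x.2)).2.1, fun m => (ω (x.1, x.2)).2.2 m)

/-- An outcome with prescribed data in the first `T` time slots. -/
def extend [NeZero q] (x : FinOutcome L q T M) : Outcome L q := fun y =>
  if h : y.2 < T then
    ((x (y.1, ⟨y.2, h⟩)).1, (x (y.1, ⟨y.2, h⟩)).2.1,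
      fun m => if hm : m < M then (x (y.1, ⟨y.2, h⟩)).2.2 ⟨m, hm⟩ else 0)
  else (false, 0, 0)

theorem slotLaw_preimage [NeZero q] (r : unitInterval) (s : FinSlot M q) :
    slotLaw q r {y | y.1 = s.1 ∧ y.2.1 = s.2.1 ∧ ∀ m : Fin M, y.2.2 m = s.2.2 m}
      = ENNReal.ofReal (slotWeight M q r s) := by
  have h1 : IsProbabilityMeasure (uniformOn (Set.univ : Set (Fin q))) :=
    isProbabilityMeasure_uniformOn Set.finite_univ Set.univ_nonempty
  have h2 : IsProbabilityMeasure (uniformOn (Set.univ : Set (ZMod 2))) :=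
    isProbabilityMeasure_uniformOn Set.finite_univ Set.univ_nonempty
  have hset : {y : Slot q | y.1 = s.1 ∧ y.2.1 = s.2.1 ∧ ∀ m : Fin M, y.2.2 m = s.2.2 m}
      = {s.1} ×ˢ ({s.2.1} ×ˢ Set.pi (Finset.range M : Set ℕ)
          (fun m => {a | ∀ h : m < M, a = s.2.2 ⟨m, h⟩})) := by
    ext y
    simp only [Set.mem_ofPred_eq, Set.mem_prod, Set.mem_singleton_iff, Set.mem_pi, Finset.coe_range,
      Set.mem_Iio]
    refine and_congr Iff.rfl (and_congr Iff.rfl ⟨fun h m hm _ => h ⟨m, hm⟩, fun h m => h m m.2 m.2⟩)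
  have hr0 := r.2.1
  have hr1 := r.2.2
  rw [hset, slotLaw, Measure.prod_prod, Measure.prod_prod, Measure.infinitePi_pi _
    (fun _ _ => MeasurableSet.of_discrete)]
  have hcoef : ∏ m ∈ Finset.range M, uniformOn (Set.univ : Set (ZMod 2))
      {a | ∀ h : m < M, a = s.2.2 ⟨m, h⟩} = ENNReal.ofReal ((1 / 2) ^ M) := by
    have : ∀ m ∈ Finset.range M, uniformOn (Set.univ : Set (ZMod 2))
      {a | ∀ h : m < M, a = s.2.2 ⟨m, h⟩} = ENNReal.ofReal (1 / 2) := by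
      intro m hm
      have hm' := Finset.mem_range.1 hm
      have he : {a | ∀ h : m < M, a = s.2.2 ⟨m, h⟩} = {s.2.2 ⟨m, hm'⟩} := by
        ext a; simp [hm']
      rw [he, uniformOn_univ, Measure.count_singleton, ZMod.card,
        ENNReal.ofReal_div_of_pos (by norm_num)]
      simp
    rw [Finset.prod_congr rfl this, Finset.prod_const, Finset.card_range,
      ENNReal.ofReal_pow (by norm_num)]
  have hchunk : uniformOn (Set.univ : Set (Fin q)) {s.2.1} = ENNReal.ofReal (1 / q) := by
    rw [uniformOn_univ, Measure.count_singleton, Fintype.card_fin,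
      ENNReal.ofReal_div_of_pos (Nat.cast_pos.2 (NeZero.pos q))]
    simp
  have hsucc : bernoulliMeasure true false r {s.1}
      = ENNReal.ofReal (if s.1 = true then (r : ℝ) else 1 - r) := by
    rw [bernoulliMeasure_apply _ (MeasurableSet.of_discrete)]
    cases s.1
    · simp
      rw [ENNReal.ofReal, ENNReal.coe_inj]
      ext
      simp [hr1]
    · simp
      rw [ENNReal.ofReal, ENNReal.coe_inj]
      ext
      simp [hr0]
  rw [hcoef, hchunk, hsucc, slotWeight, ENNReal.ofReal_mul, ENNReal.ofReal_mul]
  · positivity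
  · split_ifs <;> linarith

theorem law_truncate_eq [NeZero q] (N : LineNetwork L) (x : FinOutcome L q T M) :
    law N q {ω | truncate T M ω = x}
      = ENNReal.ofReal (∏ y : Fin L × Fin T, slotWeight M q (N.p y.1) (x y)) := by
  classical
  set e : Fin L × Fin T ↪ Fin L × ℕ :=
    (Function.Embedding.refl _).prodMap ⟨Fin.val, Fin.val_injective⟩ with he
  have hset : {ω : Outcome L q | truncate T M ω = x}
      = Set.pi ((Finset.univ.map e : Finset (Fin L × ℕ)) : Set (Fin L × ℕ))
        (fun z => {y : Slot q | ∀ h : z.2 < T, y.1 = (x (z.1, ⟨z.2, h⟩)).1 ∧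
          y.2.1 = (x (z.1, ⟨z.2, h⟩)).2.1 ∧
          ∀ m : Fin M, y.2.2 m = (x (z.1, ⟨z.2, h⟩)).2.2 m}) := by
    ext ω
    simp only [Set.mem_ofPred_eq, Set.mem_pi, Finset.mem_coe, Finset.mem_map, Finset.mem_univ,
      true_and, forall_exists_index, forall_apply_eq_imp_iff]
    rw [funext_iff]
    refine forall_congr' fun y => ?_
    simp only [he, Function.Embedding.prodMap, Function.Embedding.refl_apply,
      Function.Embedding.coeFn_mk, Prod.map, y.2.2, truncate, forall_true_left, Prod.ext_iff,
      funext_iff]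
  have hmeas : ∀ s : FinSlot M q, MeasurableSet
      {y : Slot q | y.1 = s.1 ∧ y.2.1 = s.2.1 ∧ ∀ m : Fin M, y.2.2 m = s.2.2 m} := by
    intro s
    have h : {y : Slot q | y.1 = s.1 ∧ y.2.1 = s.2.1 ∧ ∀ m : Fin M, y.2.2 m = s.2.2 m}
        = Prod.fst ⁻¹' {s.1} ∩ ((fun y => y.2.1) ⁻¹' {s.2.1} ∩
          ⋂ m : Fin M, (fun y => y.2.2 m) ⁻¹' {s.2.2 m}) := by
      ext y; simp
    rw [h]
    refine ((measurableSet_singleton s.1).preimage measurable_fst).inter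
      (((measurableSet_singleton s.2.1).preimage (measurable_fst.comp measurable_snd)).inter
        (MeasurableSet.iInter fun m => ?_))
    exact (measurableSet_singleton (s.2.2 m)).preimage
      ((measurable_pi_apply (m : ℕ)).comp (measurable_snd.comp measurable_snd))
  rw [hset, law, Measure.infinitePi_pi, Finset.prod_map, ENNReal.ofReal_prod_of_nonneg]
  · refine Finset.prod_congr rfl fun y _ => ?_
    rw [← slotLaw_preimage (M := M) ⟨N.p y.1, (N.p_pos y.1).le, N.p_le_one y.1⟩]
    simp only [he, Function.Embedding.prodMap, Function.Embedding.refl_apply,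
      Function.Embedding.coeFn_mk, Prod.map, y.2.2, forall_true_left]
  · exact fun y _ => slotWeight_nonneg (N.p_pos y.1).le (N.p_le_one y.1) _
  · intro z hz
    obtain ⟨y, -, rfl⟩ := Finset.mem_map.1 hz
    have := hmeas (x y)
    simpa [he] using this

open Classical in
theorem law_le_expect [NeZero q] (N : LineNetwork L) (A : Set (FinOutcome L q T M)) :
    law N q {ω | truncate T M ω ∈ A}
      ≤ ENNReal.ofReal (expect (fun y : Fin L × Fin T => slotWeight M q (N.p y.1))
          (fun x => if x ∈ A then 1 else 0)) := by
  have hset : {ω : Outcome L q | truncate T M ω ∈ A}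
      = ⋃ x ∈ Finset.univ.filter (· ∈ A), {ω | truncate T M ω = x} := by
    ext ω; simp
  rw [hset]
  refine (measure_biUnion_finset_le _ _).trans_eq ?_
  simp only [law_truncate_eq]
  rw [← ENNReal.ofReal_sum_of_nonneg]
  · congr 1
    simp only [expect, mul_ite, mul_one, mul_zero, Finset.sum_filter]
  · exact fun x _ => Finset.prod_nonneg fun y _ =>
      slotWeight_nonneg (N.p_pos y.1).le (N.p_le_one y.1) _

end Truncation

/-! ### Locality: which random data decide a chunk, and the link from chunks to the delay. -/

section Congruence

variable {L q T M α : ℕ}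

/-- The data of two transmissions agree as far as chunk `c` and the first `M` coefficients are
concerned. -/
def Agree (c : Fin q) (M : ℕ) (s s' : Slot q) : Prop :=
  (s.2.1 = c ↔ s'.2.1 = c) ∧ (s.2.1 = c → s.1 = s'.1 ∧ ∀ m < M, s.2.2 m = s'.2.2 m)

theorem Agree.refl (c : Fin q) (M : ℕ) (s : Slot q) : Agree c M s s :=
  ⟨Iff.rfl, fun _ => ⟨rfl, fun _ _ => rfl⟩⟩

/-- The source reads coefficients with index below `α`, and a relay in slot `t` reads those indexed
by earlier slots, always on packets of the same chunk. Hence `M` coefficients suffice once `M`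
bounds both `α` and the time. -/
theorem globalVector_congr {ω ω' : Outcome L q} {c : Fin q} (hα : α ≤ M) {i : ℕ} (hi : i < L)
    {t : ℕ} (ht : t ≤ M) (h : ∀ j, ∀ s ≤ t, Agree c M (ω (j, s)) (ω' (j, s)))
    (hc : chunk ω ⟨i, hi⟩ t = c) :
    globalVector α ω i hi t = globalVector α ω' i hi t := by
  induction i generalizing t with
  | zero =>
    funext m
    exact ((h ⟨0, hi⟩ t le_rfl).2 hc).2 m (m.2.trans_le hα)
  | succ i ih =>
    have hc' : chunk ω' ⟨i + 1, hi⟩ t = c := (h _ t le_rfl).1.1 hc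
    simp only [globalVector]
    refine Finset.sum_congr rfl fun s hs => ?_
    have hst := Finset.mem_range.1 hs
    have hA := h ⟨i, by omega⟩ s hst.le
    have hiff : (success ω ⟨i, by omega⟩ s ∧ chunk ω ⟨i, by omega⟩ s = c)
        ↔ (success ω' ⟨i, by omega⟩ s ∧ chunk ω' ⟨i, by omega⟩ s = c) := by
      constructor
      · rintro ⟨h1, h2⟩
        exact ⟨by rw [success, ← (hA.2 h2).1]; exact h1, hA.1.1 h2⟩
      · rintro ⟨h1, h2⟩
        have h3 := hA.1.2 h2
        exact ⟨by rw [success, (hA.2 h3).1]; exact h1, h3⟩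
    by_cases hs1 : success ω ⟨i, by omega⟩ s ∧ chunk ω ⟨i, by omega⟩ s = c
    · rw [if_pos ⟨hs1.1, hs1.2.trans hc.symm⟩,
        if_pos ⟨(hiff.1 hs1).1, (hiff.1 hs1).2.trans hc'.symm⟩, ih (by omega) (by omega)
        (fun j r hr => h j r (hr.trans hst.le)) hs1.2]
      congr 1
      exact ((h _ t le_rfl).2 hc).2 s (by omega)
    · rw [if_neg fun h' => hs1 ⟨h'.1, h'.2.trans hc⟩,
        if_neg fun h' => hs1 (hiff.2 ⟨h'.1, h'.2.trans hc'⟩)]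

theorem ChunkDecodable.congr {ω ω' : Outcome L q} {c : Fin q} (hα : α ≤ M) (hT : T ≤ M)
    (h : ∀ j, ∀ s < T, Agree c M (ω (j, s)) (ω' (j, s))) (hd : ChunkDecodable α ω T c) :
    ChunkDecodable α ω' T c := by
  obtain ⟨i, hi, hspan⟩ := hd
  refine ⟨i, hi, top_le_iff.1 (hspan ▸ Submodule.span_mono ?_)⟩
  rintro v ⟨t, ht, hs, hc, rfl⟩
  have hA := h i t ht
  refine ⟨t, ht, ?_, hA.1.1 hc, ?_⟩
  · rw [success, ← (hA.2 hc).1]; exact hs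
  · exact globalVector_congr hα i.2 (by omega) (fun j s hst => h j s (by omega)) hc

theorem Agree.symm {c : Fin q} {s s' : Slot q} (h : Agree c M s s') : Agree c M s' s :=
  ⟨h.1.symm, fun h' => ⟨((h.2 (h.1.2 h')).1).symm, fun m hm => ((h.2 (h.1.2 h')).2 m hm).symm⟩⟩

theorem chunkDecodable_congr {ω ω' : Outcome L q} {c : Fin q} (hα : α ≤ M) (hT : T ≤ M)
    (h : ∀ j, ∀ s < T, Agree c M (ω (j, s)) (ω' (j, s))) :
    ChunkDecodable α ω T c ↔ ChunkDecodable α ω' T c :=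
  ⟨.congr hα hT h, .congr hα hT fun j s hs => (h j s hs).symm⟩

theorem agree_extend_truncate [NeZero q] (ω : Outcome L q) (c : Fin q) (j : Fin L) {s : ℕ}
    (hs : s < T) : Agree c M (ω (j, s)) (extend (truncate T M ω) (j, s)) := by
  simp only [extend, hs, dif_pos, truncate]
  exact ⟨Iff.rfl, fun _ => ⟨rfl, fun m hm => by simp [hm]⟩⟩

theorem chunkDecodable_extend_truncate [NeZero q] (hα : α ≤ M) (hT : T ≤ M) (ω : Outcome L q)
    (c : Fin q) : ChunkDecodable α (extend (truncate T M ω)) T c ↔ ChunkDecodable α ω T c :=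
  (chunkDecodable_congr hα hT fun j _ hs => agree_extend_truncate ω c j hs).symm

open Classical in
/-- The number of chunks that are not decodable after `T` time slots. -/
def undecodableCount (α : ℕ) (ω : Outcome L q) (T : ℕ) : ℕ :=
  (Finset.univ.filter fun c => ¬ ChunkDecodable α ω T c).card

theorem undecodableCount_extend_truncate [NeZero q] (hα : α ≤ M) (hT : T ≤ M) (ω : Outcome L q) :
    undecodableCount α (extend (truncate T M ω)) T = undecodableCount α ω T := by
  classical
  unfold undecodableCount
  congr 1
  ext c
  simp [chunkDecodable_extend_truncate hα hT]

/-- Only the chunk picked before the change and the one picked after it can be affected. -/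
theorem undecodableCount_update_le [NeZero q] (hα : α ≤ M) (hT : T ≤ M)
    (x : FinOutcome L q T M) (y : Fin L × Fin T) (s : FinSlot M q) :
    undecodableCount α (extend (Function.update x y s)) T
      ≤ undecodableCount α (extend x) T + 2 := by
  classical
  have hsub : (Finset.univ.filter fun c =>
      ¬ ChunkDecodable α (extend (Function.update x y s)) T c)
      ⊆ (Finset.univ.filter fun c => ¬ ChunkDecodable α (extend x) T c) ∪ {s.2.1, (x y).2.1} := by
    intro c hc
    by_cases hcs : c = s.2.1 ∨ c = (x y).2.1
    · simp only [Finset.mem_union, Finset.mem_insert, Finset.mem_singleton]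
      exact .inr hcs
    push Not at hcs
    simp only [Finset.mem_filter, Finset.mem_univ, true_and] at hc
    simp only [Finset.mem_union, Finset.mem_filter, Finset.mem_univ, true_and]
    left
    rwa [chunkDecodable_congr hα hT]
    intro j r hr
    simp only [extend, hr, dif_pos]
    by_cases hy : ((j, ⟨r, hr⟩) : Fin L × Fin T) = y
    · subst hy
      simp only [Function.update_self]
      exact ⟨iff_of_false (fun h => hcs.2 h.symm) (fun h => hcs.1 h.symm),
        fun h => absurd h.symm hcs.2⟩
    · rw [Function.update_of_ne hy]
      exact Agree.refl _ _ _
  unfold undecodableCount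
  calc _ ≤ _ := Finset.card_le_card hsub
    _ ≤ _ := (Finset.card_union_le _ _).trans (Nat.add_le_add_left Finset.card_le_two _)

theorem abs_undecodableCount_sub_update_le [NeZero q] (hα : α ≤ M) (hT : T ≤ M)
    (x : FinOutcome L q T M) (y : Fin L × Fin T) (s : FinSlot M q) :
    |(undecodableCount α (extend x) T : ℝ)
      - undecodableCount α (extend (Function.update x y s)) T| ≤ 2 := by
  have h1 := undecodableCount_update_le hα hT x y s
  have h2 := undecodableCount_update_le hα hT (Function.update x y s) y (x y)
  rw [Function.update_idem, Function.update_eq_self] at h2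
  have h1' : (undecodableCount α (extend (Function.update x y s)) T : ℝ)
    ≤ undecodableCount α (extend x) T + 2 := by exact_mod_cast h1
  have h2' : (undecodableCount α (extend x) T : ℝ)
    ≤ undecodableCount α (extend (Function.update x y s)) T + 2 := by exact_mod_cast h2
  rw [abs_le]
  constructor <;> linarith

/-- If few chunks are undecodable then the precode recovers the message. -/
theorem messageRecovered_of_undecodableCount_le {k : ℕ} {F : Type*}
    {encode : (Fin k → F) → (Fin q × Fin α → F)} {δ : ℝ} (he : CorrectsErasures encode δ)
    {ω : Outcome L q} (h : (undecodableCount α ω T : ℝ) ≤ δ * q) :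
    MessageRecovered encode ω T := by
  classical
  intro u v huv
  refine he ((Finset.univ.filter fun c => ¬ ChunkDecodable α ω T c) ×ˢ Finset.univ) ?_ u v ?_
  · rw [Finset.card_product, Finset.card_univ, Fintype.card_fin]
    push_cast
    rw [← mul_assoc]
    refine mul_le_mul_of_nonneg_right ?_ (Nat.cast_nonneg _)
    unfold undecodableCount at h
    convert h
  · rintro ⟨c, m⟩ hx
    refine huv c ?_ m
    simpa using hx

theorem undecodableCount_of_lt_codingDelay {k : ℕ} {F : Type*}
    {encode : (Fin k → F) → (Fin q × Fin α → F)} {δ : ℝ} (he : CorrectsErasures encode δ)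
    {ω : Outcome L q} {τ : ℝ} (hτ : 0 ≤ τ) (h : ENNReal.ofReal τ < codingDelay encode ω) :
    δ * q < undecodableCount α ω ⌊τ⌋₊ := by
  by_contra! hle
  have h1 := messageRecovered_of_undecodableCount_le he hle
  have h2 : codingDelay encode ω ≤ (⌊τ⌋₊ : ℝ≥0∞) := iInf₂_le _ h1
  have h3 : ((⌊τ⌋₊ : ℕ) : ℝ≥0∞) ≤ ENNReal.ofReal τ := by
    rw [← ENNReal.ofReal_natCast]
    exact ENNReal.ofReal_le_ofReal (Nat.floor_le hτ)
  exact absurd h (not_lt.2 (h2.trans h3))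

end Congruence

/-! ### The race of a token driven by fair coins. -/

section CoinRace

/-! A token starts at position `l`. In slot `t` it moves one step if `R l t` holds and a fair coin
shows heads. -/

open Classical in
/-- The probability that the token, at position `l` in slot `t`, has not reached position `L` after
`d` further slots. -/
def raceFailure (R : ℕ → ℕ → Prop) (L : ℕ) : ℕ → ℕ → ℕ → ℝ
  | 0, l, _ => if l < L then 1 else 0
  | d + 1, l, t =>
      if R l t then (raceFailure R L d l (t + 1) + raceFailure R L d (l + 1) (t + 1)) / 2
      else raceFailure R L d l (t + 1)

variable {R : ℕ → ℕ → Prop} {L : ℕ}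

theorem raceFailure_nonneg (d l t : ℕ) : 0 ≤ raceFailure R L d l t := by
  induction d generalizing l t with
  | zero => rw [raceFailure]; split_ifs <;> norm_num
  | succ d ih =>
    rw [raceFailure]
    have h1 := ih l (t + 1)
    have h2 := ih (l + 1) (t + 1)
    split_ifs <;> linarith

theorem raceFailure_succ_le_of_le {d l t : ℕ}
    (h : raceFailure R L d (l + 1) (t + 1) ≤ raceFailure R L d l (t + 1)) :
    raceFailure R L (d + 1) l t ≤ raceFailure R L d l (t + 1) := by
  rw [raceFailure]
  split_ifs <;> linarith

theorem raceFailure_position_succ_le (d l t : ℕ) :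
    raceFailure R L d (l + 1) t ≤ raceFailure R L d l t := by
  induction d generalizing l t with
  | zero => simp only [raceFailure]; split_ifs <;> first | omega | norm_num
  | succ d ih =>
    refine (raceFailure_succ_le_of_le (ih (l + 1) (t + 1))).trans ?_
    have := ih l (t + 1)
    rw [raceFailure]
    split_ifs <;> linarith

/-- Moving forward never hurts, so discarding the first `a` slots can only increase the failure
probability. -/
theorem raceFailure_add_le (a e l t : ℕ) :
    raceFailure R L (a + e) l t ≤ raceFailure R L e l (t + a) := by
  induction a generalizing t with
  | zero => simp
  | succ a ih =>
    rw [show a + 1 + e = (a + e) + 1 by ring, show t + (a + 1) = t + 1 + a by ring]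
    exact (raceFailure_succ_le_of_le (raceFailure_position_succ_le _ _ _)).trans (ih (t + 1))

theorem raceFailure_le_one (d l t : ℕ) : raceFailure R L d l t ≤ 1 := by
  refine (raceFailure_add_le d 0 l t).trans ?_
  rw [raceFailure]
  split_ifs <;> norm_num

theorem raceFailure_of_le (d t : ℕ) {l : ℕ} (h : L ≤ l) : raceFailure R L d l t = 0 := by
  refine le_antisymm ((raceFailure_add_le d 0 l t).trans_eq ?_) (raceFailure_nonneg _ _ _)
  rw [raceFailure, if_neg (by omega)]

-- Either every coin at position `l` in the window shows tails, or the token has advanced at least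
-- once. In the second case its probability is bounded by 1 and, by monotonicity, it may be put at
-- `l + 1` at the end of the window.
open Classical in
theorem raceFailure_window_le (a e l t : ℕ) :
    raceFailure R L (a + e) l t
      ≤ (1 / 2) ^ ((Finset.Ico t (t + a)).filter (R l)).card * raceFailure R L e l (t + a)
        + raceFailure R L e (l + 1) (t + a) := by
  induction a generalizing t with
  | zero => simpa using raceFailure_nonneg _ _ _
  | succ a ih =>
    have h1 := ih (t + 1)
    have h2 := raceFailure_add_le (R := R) (L := L) a e (l + 1) (t + 1)
    rw [show a + 1 + e = (a + e) + 1 by ring, show t + (a + 1) = t + 1 + a by ring, raceFailure,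
      ← Finset.insert_Ico_add_one_left_eq_Ico (show t < t + 1 + a by omega), Finset.filter_insert]
    split_ifs with hR
    · rw [Finset.card_insert_of_notMem (by simp), pow_succ]
      linarith
    · exact h1

-- Each window either costs a factor `θ` or yields a step. A losing token makes at most `L - l - 1`
-- steps, and `2 ^ j` counts the patterns of stuck windows. The truncated exponent makes the bound
-- at least 1 when there are too few windows.
open Classical in
theorem raceFailure_windows_le {θ : ℝ} (h0 : 0 ≤ θ) (h1 : θ ≤ 1) {b r : ℕ} (j : ℕ) {l t : ℕ}
    (hl : l ≤ L)
    (h : ∀ i < j, ∀ l < L,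
      (1 / 2 : ℝ) ^ ((Finset.Ico (t + i * b) (t + i * b + b)).filter (R l)).card ≤ θ) :
    raceFailure R L (j * b + r) l t ≤ 2 ^ j * θ ^ (j + 1 - (L - l)) := by
  induction j generalizing l t with
  | zero =>
    rcases hl.lt_or_eq with hl | rfl
    · rw [show 0 + 1 - (L - l) = 0 by omega]
      simpa using raceFailure_le_one _ _ _
    · rw [raceFailure_of_le _ _ le_rfl]; positivity
  | succ j ih =>
    rcases hl.lt_or_eq with hl | rfl
    swap
    · rw [raceFailure_of_le _ _ le_rfl]; positivity
    have hnext : ∀ i < j, ∀ l < L, (1 / 2 : ℝ) ^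
        ((Finset.Ico (t + b + i * b) (t + b + i * b + b)).filter (R l)).card ≤ θ := by
      intro i hi l hl
      have := h (i + 1) (by omega) l hl
      rwa [show t + (i + 1) * b = t + b + i * b by ring] at this
    have e1 := ih (t := t + b) hl.le hnext
    have e2 := ih (t := t + b) (l := l + 1) hl hnext
    have e3 := h 0 (by omega) l hl
    rw [zero_mul, add_zero] at e3
    rw [show (j + 1) * b + r = b + (j * b + r) by ring]
    -- Strict only when the subtraction truncates, hence an inequality that needs `θ ≤ 1`.
    have hp : θ * θ ^ (j + 1 - (L - l)) ≤ θ ^ (j + 1 + 1 - (L - l)) := by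
      rw [← pow_succ']
      exact pow_le_pow_of_le_one h0 h1 (by omega)
    calc _ ≤ _ := raceFailure_window_le b (j * b + r) l t
      _ ≤ θ * (2 ^ j * θ ^ (j + 1 - (L - l))) + 2 ^ j * θ ^ (j + 1 - (L - (l + 1))) :=
          add_le_add (mul_le_mul e3 e1 (raceFailure_nonneg _ _ _) h0) e2
      _ = 2 ^ j * (θ * θ ^ (j + 1 - (L - l))) + 2 ^ j * θ ^ (j + 1 + 1 - (L - l)) := by
          rw [show j + 1 - (L - (l + 1)) = j + 1 + 1 - (L - l) by omega]; ring
      _ ≤ 2 ^ j * θ ^ (j + 1 + 1 - (L - l)) + 2 ^ j * θ ^ (j + 1 + 1 - (L - l)) := by gcongr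
      _ = _ := by ring

end CoinRace

/-! ### The frontier of nodes that know something not orthogonal to `u`. -/

section Frontier

variable {L q T M α : ℕ}

/-- A packet of chunk `c` arrives over link `i` in slot `t`. -/
def Arrival (ω : Outcome L q) (c : Fin q) (i t : ℕ) : Prop :=
  ∃ h : i < L, success ω ⟨i, h⟩ t ∧ chunk ω ⟨i, h⟩ t = c

/-- A packet of chunk `c` whose global encoding vector is not orthogonal to `u` arrives over link
`i` in slot `t`. -/
def Hit (u : Fin α → ZMod 2) (ω : Outcome L q) (c : Fin q) (i t : ℕ) : Prop :=
  ∃ h : i < L, (success ω ⟨i, h⟩ t ∧ chunk ω ⟨i, h⟩ t = c) ∧ u ⬝ᵥ globalVector α ω i h t ≠ 0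

theorem hit_congr {u : Fin α → ZMod 2} {ω ω' : Outcome L q} {c : Fin q} {i t : ℕ}
    (h : ∀ j, ∀ s ≤ t, ω (j, s) = ω' (j, s)) : Hit u ω c i t ↔ Hit u ω' c i t := by
  refine exists_congr fun hi => ?_
  have hg : chunk ω ⟨i, hi⟩ t = c → globalVector α ω i hi t = globalVector α ω' i hi t :=
    globalVector_congr (le_max_left α t) hi (le_max_right α t)
      (fun j s hs => by rw [h j s hs]; exact Agree.refl _ _ _)
  simp only [success, chunk, h _ t le_rfl] at hg ⊢
  constructor
  · rintro ⟨h1, h2⟩; exact ⟨h1, by rwa [← hg h1.2]⟩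
  · rintro ⟨h1, h2⟩; exact ⟨h1, by rwa [hg h1.2]⟩

open Classical in
/-- A node that can send packets not orthogonal to `u` in slot `t`, together with the index of a
coefficient that multiplies a vector not orthogonal to `u`. -/
def frontier (u : Fin α → ZMod 2) (ω : Outcome L q) (c : Fin q) (m : ℕ) : ℕ → ℕ × ℕ
  | 0 => (0, m)
  | t + 1 =>
      if Hit u ω c (frontier u ω c m t).1 t then ((frontier u ω c m t).1 + 1, t)
      else frontier u ω c m t

variable {u : Fin α → ZMod 2} {ω ω' : Outcome L q} {c : Fin q} {m : ℕ}

theorem frontier_succ_of_hit {t i s : ℕ}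
    (hf : frontier u ω c m t = (i, s)) (h : Hit u ω c i t) :
    frontier u ω c m (t + 1) = (i + 1, t) := by
  rw [frontier, hf, if_pos h]

theorem frontier_succ_of_not_hit {t i s : ℕ}
    (hf : frontier u ω c m t = (i, s)) (h : ¬ Hit u ω c i t) :
    frontier u ω c m (t + 1) = (i, s) := by
  rw [frontier, hf, if_neg h]

theorem frontier_congr {t : ℕ} (h : ∀ j, ∀ s < t, ω (j, s) = ω' (j, s)) :
    frontier u ω c m t = frontier u ω' c m t := by
  induction t with
  | zero => rfl
  | succ t ih =>
    have h1 := ih fun j s hs => h j s (by omega)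
    have h2 := hit_congr (u := u) (c := c) (i := (frontier u ω' c m t).1)
      (fun j s (hs : s ≤ t) => h j s (by omega))
    rw [frontier, frontier, h1]
    by_cases h3 : Hit u ω c (frontier u ω' c m t).1 t
    · rw [if_pos h3, if_pos (h2.1 h3)]
    · rw [if_neg h3, if_neg fun h' => h3 (h2.2 h')]

theorem frontier_snd_lt (hm : m < M) {t : ℕ} (ht : t ≤ M) : (frontier u ω c m t).2 < M := by
  induction t with
  | zero => exact hm
  | succ t ih =>
    rw [frontier]
    split_ifs
    · exact ht
    · exact ih (by omega)

/-- The invariant behind the second component: beyond the source it is the slot of an earlier hit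
over the preceding link, so the coefficient with that index multiplies a vector not orthogonal to
`u`. -/
theorem frontier_cases (t : ℕ) : frontier u ω c m t = (0, m) ∨
    ∃ i s, frontier u ω c m t = (i + 1, s) ∧ s < t ∧ Hit u ω c i s := by
  induction t with
  | zero => exact .inl rfl
  | succ t ih =>
    rw [frontier]
    split_ifs with h
    · exact .inr ⟨_, _, rfl, by omega, h⟩
    · rcases ih with h1 | ⟨i, s, h1, h2, h3⟩
      · exact .inl h1
      · exact .inr ⟨i, s, h1, by omega, h3⟩

theorem frontier_fst_lt (hL : 0 < L) {t : ℕ} (h : ∀ s < t, ¬ Hit u ω c (L - 1) s) :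
    (frontier u ω c m t).1 < L := by
  rcases frontier_cases (u := u) (ω := ω) (c := c) (m := m) t with h1 | ⟨i, s, h1, h2, h3⟩
  · rw [h1]; exact hL
  · rw [h1]
    have hi : i < L := h3.1
    have : i ≠ L - 1 := by
      rintro rfl
      exact h s h2 h3
    show i + 1 < L
    omega

/-- A chunk that is not decodable has a nonzero vector orthogonal to everything received. -/
theorem exists_forall_not_hit (hL : 0 < L) (h : ¬ ChunkDecodable α ω T c) :
    ∃ u : Fin α → ZMod 2, u ≠ 0 ∧ ∀ t < T, ¬ Hit u ω c (L - 1) t := by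
  set S := Submodule.span (ZMod 2) {v | ∃ t < T, success ω ⟨L - 1, by omega⟩ t ∧
    chunk ω ⟨L - 1, by omega⟩ t = c ∧ v = globalVector α ω (L - 1) (by omega) t} with hS
  have hne : S < ⊤ := lt_top_iff_ne_top.2 fun h' => h ⟨⟨L - 1, by omega⟩, by
    show L - 1 + 1 = L; omega, h'⟩
  obtain ⟨f, hf, hle⟩ := Submodule.exists_le_ker_of_lt_top S hne
  have hfu : ∀ v, f v = (fun i => f (Pi.single i 1)) ⬝ᵥ v := by
    intro v
    conv_lhs => rw [← Finset.univ_sum_single v, map_sum]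
    refine Finset.sum_congr rfl fun i _ => ?_
    rw [show (Pi.single i (v i) : Fin α → ZMod 2) = v i • Pi.single i 1 by
      rw [← Pi.single_smul, smul_eq_mul, mul_one], map_smul, smul_eq_mul, mul_comm]
  refine ⟨fun i => f (Pi.single i 1), fun h0 => hf ?_, ?_⟩
  · exact LinearMap.ext fun v => by rw [hfu, h0, zero_dotProduct, LinearMap.zero_apply]
  · rintro t ht ⟨hi, hsc, hne⟩
    refine hne ?_
    rw [← hfu]
    exact hle (Submodule.subset_span ⟨t, ht, hsc.1, hsc.2, rfl⟩)

/-- Flip one coefficient of a transmission. -/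
def flipCoeff (s : Slot q) (m : ℕ) : Slot q := (s.1, s.2.1, Function.update s.2.2 m (s.2.2 m + 1))

theorem zmod_two_add_ne_zero_iff {a b : ZMod 2} (hb : b ≠ 0) : a + b ≠ 0 ↔ ¬ a ≠ 0 := by
  revert a b; decide

-- Flipping the recorded coefficient adds to the transmitted vector one vector not orthogonal to
-- `u`. Over `𝔽₂` this toggles whether the dot product with `u` vanishes.
open Classical in
theorem hit_flip {i t s : ℕ} (hi : i < L) (hf : frontier u ω c m t = (i, s))
    (hm : ∃ h : m < α, u ⟨m, h⟩ ≠ 0) (ha : Arrival ω c i t)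
    (hω : ω' = Function.update ω (⟨i, hi⟩, t) (flipCoeff (ω (⟨i, hi⟩, t)) s)) :
    Hit u ω' c i t ↔ ¬ Hit u ω c i t := by
  obtain ⟨_, hsc⟩ := ha
  have hself : ω' (⟨i, hi⟩, t) = flipCoeff (ω (⟨i, hi⟩, t)) s := by
    rw [hω, Function.update_self]
  have hne : ∀ j r, r ≠ t → ω' (j, r) = ω (j, r) := by
    intro j r hr
    rw [hω, Function.update_of_ne]
    simp [hr]
  have hsc' : success ω' ⟨i, hi⟩ t ∧ chunk ω' ⟨i, hi⟩ t = c := by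
    simpa only [success, chunk, hself, flipCoeff] using hsc
  have hcoef : ∀ r, coeff ω' ⟨i, hi⟩ t r = coeff ω ⟨i, hi⟩ t r + if r = s then 1 else 0 := by
    intro r
    simp only [coeff, hself, flipCoeff]
    by_cases hr : r = s
    · subst hr; simp
    · simp [hr]
  suffices ∃ b : ZMod 2, b ≠ 0 ∧
      u ⬝ᵥ globalVector α ω' i hi t = u ⬝ᵥ globalVector α ω i hi t + b by
    obtain ⟨b, hb, hdot⟩ := this
    constructor
    · rintro ⟨_, _, h1⟩ ⟨_, _, h2⟩
      rw [hdot] at h1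
      exact (zmod_two_add_ne_zero_iff hb).1 h1 h2
    · intro h1
      refine ⟨hi, hsc', ?_⟩
      rw [hdot]
      exact (zmod_two_add_ne_zero_iff hb).2 fun h2 => h1 ⟨hi, hsc, h2⟩
  rcases frontier_cases (u := u) (ω := ω) (c := c) (m := m) t with h1 | ⟨j, r, h1, hrt, hhit⟩
  · rw [hf, Prod.mk.injEq] at h1
    obtain ⟨rfl, rfl⟩ := h1
    obtain ⟨hmα, hum⟩ := hm
    refine ⟨u ⟨s, hmα⟩, hum, ?_⟩
    have : globalVector α ω' 0 hi t = globalVector α ω 0 hi t + Pi.single ⟨s, hmα⟩ 1 := by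
      funext r
      simp only [globalVector, hcoef, Pi.add_apply, Pi.single_apply, Fin.ext_iff]
    rw [this, dotProduct_add, dotProduct_single, mul_one]
  · rw [hf, Prod.mk.injEq] at h1
    obtain ⟨rfl, rfl⟩ := h1
    obtain ⟨hj, hjsc, hdot⟩ := hhit
    -- The flip takes place in slot `t`, so the vectors from earlier slots are unchanged, and only
    -- the summand of slot `s` in the relay's combination changes.
    refine ⟨_, hdot, ?_⟩
    rw [← dotProduct_add]
    congr 1
    have hg : ∀ r < t, chunk ω ⟨j, hj⟩ r = c →
        globalVector α ω' j hj r = globalVector α ω j hj r := fun r hr hc =>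
      (globalVector_congr (le_max_left α r) hj (le_max_right α r) (fun j' r' hr' => by
        rw [hne j' r' (by omega)]; exact Agree.refl _ _ _) hc).symm
    simp only [globalVector]
    rw [← Finset.sum_erase_add _ _ (Finset.mem_range.2 hrt),
      ← Finset.sum_erase_add (Finset.range t) _ (Finset.mem_range.2 hrt), add_assoc]
    have hterm : ∀ r < t, (if success ω' ⟨j, hj⟩ r ∧ chunk ω' ⟨j, hj⟩ r = chunk ω' ⟨j + 1, hi⟩ t
        then coeff ω' ⟨j + 1, hi⟩ t r • globalVector α ω' j hj r else 0)
        = (if success ω ⟨j, hj⟩ r ∧ chunk ω ⟨j, hj⟩ r = chunk ω ⟨j + 1, hi⟩ t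
          then coeff ω' ⟨j + 1, hi⟩ t r • globalVector α ω j hj r else 0) := by
      intro r hr
      have e : (success ω' ⟨j, hj⟩ r ∧ chunk ω' ⟨j, hj⟩ r = chunk ω' ⟨j + 1, hi⟩ t)
          ↔ (success ω ⟨j, hj⟩ r ∧ chunk ω ⟨j, hj⟩ r = chunk ω ⟨j + 1, hi⟩ t) := by
        rw [hsc.2, hsc'.2]
        simp only [success, chunk, hne _ r hr.ne]
      by_cases h : success ω ⟨j, hj⟩ r ∧ chunk ω ⟨j, hj⟩ r = chunk ω ⟨j + 1, hi⟩ t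
      · rw [if_pos h, if_pos (e.2 h), hg r hr (h.2.trans hsc.2)]
      · rw [if_neg h, if_neg (fun h' => h (e.1 h'))]
    congr 1
    · refine Finset.sum_congr rfl fun r hr => ?_
      have hr' := Finset.mem_erase.1 hr
      rw [hterm r (Finset.mem_range.1 hr'.2), hcoef, if_neg hr'.1, add_zero]
    · have h' : success ω ⟨j, hj⟩ s ∧ chunk ω ⟨j, hj⟩ s = chunk ω ⟨j + 1, hi⟩ t :=
        ⟨hjsc.1, hjsc.2.trans hsc.2.symm⟩
      rw [hterm s hrt, if_pos h', if_pos h', hcoef, if_pos rfl, add_smul, one_smul]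

end Frontier

/-! ### The flipping involution and the union bound over `u`. -/

section Flip

variable {L q T M α : ℕ} [NeZero q]

/-- Two outcomes have the same losses and the same chunks. -/
def SameSchedule (x x' : FinOutcome L q T M) : Prop :=
  ∀ y, (x y).1 = (x' y).1 ∧ (x y).2.1 = (x' y).2.1

/-- Flip the coefficient that decides whether the frontier advances in slot `t`. -/
def flipFrontier (u : Fin α → ZMod 2) (c : Fin q) (m : ℕ) (t : Fin T) (x : FinOutcome L q T M) :
    FinOutcome L q T M :=
  if h : (frontier u (extend x) c m t).1 < L ∧ (frontier u (extend x) c m t).2 < M then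
    Function.update x (⟨(frontier u (extend x) c m t).1, h.1⟩, t)
      ((x (⟨(frontier u (extend x) c m t).1, h.1⟩, t)).1,
        (x (⟨(frontier u (extend x) c m t).1, h.1⟩, t)).2.1,
        Function.update (x (⟨(frontier u (extend x) c m t).1, h.1⟩, t)).2.2
          ⟨(frontier u (extend x) c m t).2, h.2⟩
          ((x (⟨(frontier u (extend x) c m t).1, h.1⟩, t)).2.2
            ⟨(frontier u (extend x) c m t).2, h.2⟩ + 1))
  else x

variable {u : Fin α → ZMod 2} {c : Fin q} {m : ℕ}

theorem flipFrontier_of_lt {t : Fin T} {x : FinOutcome L q T M} {i s : ℕ}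
    (hf : frontier u (extend x) c m t = (i, s)) (hi : i < L) (hs : s < M) :
    flipFrontier u c m t x = Function.update x (⟨i, hi⟩, t) ((x (⟨i, hi⟩, t)).1,
      (x (⟨i, hi⟩, t)).2.1, Function.update (x (⟨i, hi⟩, t)).2.2 ⟨s, hs⟩
        ((x (⟨i, hi⟩, t)).2.2 ⟨s, hs⟩ + 1)) := by
  rw [flipFrontier, dif_pos (by rw [hf]; exact ⟨hi, hs⟩)]
  simp only [hf]

theorem flipFrontier_of_not {t : Fin T} {x : FinOutcome L q T M} {i s : ℕ}
    (hf : frontier u (extend x) c m t = (i, s)) (h : ¬ (i < L ∧ s < M)) :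
    flipFrontier u c m t x = x := by
  rw [flipFrontier, dif_neg (by rw [hf]; exact h)]

theorem extend_flipFrontier {t : Fin T} {x : FinOutcome L q T M} {i s : ℕ}
    (hf : frontier u (extend x) c m t = (i, s)) (hi : i < L) (hs : s < M) :
    extend (flipFrontier u c m t x) = Function.update (extend x) (⟨i, hi⟩, (t : ℕ))
      (flipCoeff (extend x (⟨i, hi⟩, (t : ℕ))) s) := by
  rw [flipFrontier_of_lt hf hi hs]
  funext y
  by_cases hy : y = (⟨i, hi⟩, (t : ℕ))
  · subst hy
    simp only [extend, Fin.is_lt, dif_pos, Fin.eta, Function.update_self, flipCoeff]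
    congr 2
    funext r
    by_cases hr : r = s
    · subst hr; simp [hs]
    · by_cases hrM : r < M
      · simp [hr, hrM]
      · simp [hr, hrM]
  · rw [Function.update_of_ne hy]
    simp only [extend]
    by_cases hT : y.2 < T
    · rw [dif_pos hT, dif_pos hT, Function.update_of_ne]
      intro h
      apply hy
      rw [Prod.ext_iff] at h ⊢
      exact ⟨h.1, congrArg Fin.val h.2⟩
    · rw [dif_neg hT, dif_neg hT]

theorem frontier_flipFrontier (t : Fin T) (x : FinOutcome L q T M) :
    frontier u (extend (flipFrontier u c m t x)) c m t = frontier u (extend x) c m t := by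
  obtain ⟨i, s, hf⟩ : ∃ i s, frontier u (extend x) c m t = (i, s) := ⟨_, _, rfl⟩
  by_cases h : i < L ∧ s < M
  · refine frontier_congr fun j r hr => ?_
    rw [extend_flipFrontier hf h.1 h.2, Function.update_of_ne]
    simp [hr.ne]
  · rw [flipFrontier_of_not hf h]

theorem flipFrontier_involutive (t : Fin T) :
    Function.Involutive (flipFrontier (L := L) (M := M) u c m t) := by
  intro x
  obtain ⟨i, s, hf⟩ : ∃ i s, frontier u (extend x) c m t = (i, s) := ⟨_, _, rfl⟩
  have hf' := frontier_flipFrontier (u := u) (c := c) (m := m) t x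
  rw [hf] at hf'
  by_cases h : i < L ∧ s < M
  · rw [flipFrontier_of_lt hf' h.1 h.2, flipFrontier_of_lt hf h.1 h.2]
    have h2 : ∀ a : ZMod 2, a + 1 + 1 = a := by decide
    simp [h2]
  · rw [flipFrontier_of_not hf' h, flipFrontier_of_not hf h]

theorem sameSchedule_flipFrontier (t : Fin T) (x : FinOutcome L q T M) :
    SameSchedule (flipFrontier u c m t x) x := by
  obtain ⟨i, s, hf⟩ : ∃ i s, frontier u (extend x) c m t = (i, s) := ⟨_, _, rfl⟩
  intro y
  by_cases h : i < L ∧ s < M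
  · rw [flipFrontier_of_lt hf h.1 h.2]
    by_cases hy : y = (⟨i, h.1⟩, t)
    · subst hy; simp
    · rw [Function.update_of_ne hy]; simp
  · rw [flipFrontier_of_not hf h]; simp

theorem SameSchedule.arrival_eq {x x' : FinOutcome L q T M} (h : SameSchedule x x') (c : Fin q) :
    Arrival (extend x) c = Arrival (extend x') c := by
  funext i t
  refine propext (exists_congr fun hi => ?_)
  simp only [success, chunk, extend]
  by_cases ht : t < T
  · simp only [ht, dif_pos, (h _).1, (h _).2]
  · simp only [ht, dif_neg, not_false_eq_true]

/-- The expected failure probability of the race that starts from the frontier does not change from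
one slot to the next. -/
theorem sum_mul_raceFailure_succ (hαM : α ≤ M) (hTM : T ≤ M) (hm : ∃ h : m < α, u ⟨m, h⟩ ≠ 0)
    {g : FinOutcome L q T M → ℝ} (hg : ∀ x x', SameSchedule x x' → g x = g x') (t : Fin T) :
    ∑ x, g x * raceFailure (Arrival (extend x) c) L (T - (t + 1))
        (frontier u (extend x) c m (t + 1)).1 (t + 1)
      = ∑ x, g x * raceFailure (Arrival (extend x) c) L (T - t)
        (frontier u (extend x) c m t).1 t := by
  set d := T - (t + 1) with hd
  have hd' : T - t = d + 1 := by have := t.2; omega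
  set h : FinOutcome L q T M → ℝ := fun x => g x * raceFailure (Arrival (extend x) c) L d
        (frontier u (extend x) c m (t + 1)).1 (t + 1) with hh
  -- Averaging over the pairs `x`, `flipFrontier u c m t x`: on an arrival exactly one member of the
  -- pair advances, which is the fair coin in the recursion of `raceFailure`.
  have hsum : ∑ x, h x = ∑ x, h (flipFrontier u c m t x) :=
    (Equiv.sum_comp (flipFrontier_involutive t).toPerm h).symm
  have hpair : ∀ x, h x + h (flipFrontier u c m t x)
      = 2 * (g x * raceFailure (Arrival (extend x) c) L (T - t)
        (frontier u (extend x) c m t).1 t) := by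
    intro x
    have hS := sameSchedule_flipFrontier (u := u) (c := c) (m := m) t x
    obtain ⟨i, s, hf⟩ : ∃ i s, frontier u (extend x) c m t = (i, s) := ⟨_, _, rfl⟩
    have hf' := frontier_flipFrontier (u := u) (c := c) (m := m) t x
    rw [hf] at hf'
    simp only [hh, hg _ _ hS, hS.arrival_eq, hf, hd', raceFailure]
    by_cases hR : Arrival (extend x) c i t
    · have hi : i < L := hR.1
      have hs : s < M := by
        have := frontier_snd_lt (u := u) (ω := extend x) (c := c) (t := t)
          (hm.1.trans_le hαM) (by have := t.2; omega)
        rwa [hf] at this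
      have hfl := hit_flip hi hf hm hR (extend_flipFrontier hf hi hs)
      rw [if_pos hR]
      by_cases hH : Hit u (extend x) c i t
      · rw [frontier_succ_of_hit hf hH, frontier_succ_of_not_hit hf' fun h' => hfl.1 h' hH]
        ring
      · rw [frontier_succ_of_not_hit hf hH, frontier_succ_of_hit hf' (hfl.2 hH)]
        ring
    · have h1 : ¬ Hit u (extend x) c i t := fun ⟨a, b, _⟩ => hR ⟨a, b⟩
      have h2 : ¬ Hit u (extend (flipFrontier u c m t x)) c i t := fun ⟨a, b, _⟩ => by
        rw [← hS.arrival_eq] at hR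
        exact hR ⟨a, b⟩
      rw [if_neg hR, frontier_succ_of_not_hit hf h1, frontier_succ_of_not_hit hf' h2]
      ring
  have : 2 * ∑ x, h x = ∑ x, 2 * (g x * raceFailure (Arrival (extend x) c) L (T - t)
        (frontier u (extend x) c m t).1 t) := by
    rw [two_mul]
    nth_rewrite 2 [hsum]
    rw [← Finset.sum_add_distrib]
    exact Finset.sum_congr rfl fun x _ => hpair x
  rw [← Finset.mul_sum] at this
  exact mul_left_cancel₀ two_ne_zero this

theorem sum_mul_raceFailure (hαM : α ≤ M) (hTM : T ≤ M) (hm : ∃ h : m < α, u ⟨m, h⟩ ≠ 0)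
    {g : FinOutcome L q T M → ℝ} (hg : ∀ x x', SameSchedule x x' → g x = g x') {t : ℕ}
    (ht : t ≤ T) :
    ∑ x, g x * raceFailure (Arrival (extend x) c) L (T - t) (frontier u (extend x) c m t).1 t
      = ∑ x, g x * raceFailure (Arrival (extend x) c) L T 0 0 := by
  induction t with
  | zero => rfl
  | succ t ih =>
    rw [← ih (by omega)]
    exact sum_mul_raceFailure_succ hαM hTM hm hg ⟨t, ht⟩

variable {r : Fin L → ℝ}

/-- The law of the first `T` slots. -/
abbrev slotWeights (r : Fin L → ℝ) (q T M : ℕ) : Fin L × Fin T → FinSlot M q → ℝ :=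
  fun y => slotWeight M q (r y.1)

-- The weights and the event `A` depend only on the schedule, so both may enter the invariant factor
-- `g`. This amounts to conditioning on the schedule.
open Classical in
theorem expect_forall_not_hit_le (hL : 0 < L) (h0 : ∀ i, 0 ≤ r i) (h1 : ∀ i, r i ≤ 1)
    (hαM : α ≤ M) (hTM : T ≤ M) (hu : u ≠ 0) {A : FinOutcome L q T M → Prop}
    (hA : ∀ x x', SameSchedule x x' → (A x ↔ A x')) {B : ℝ} (hB0 : 0 ≤ B)
    (hB : ∀ x, A x → raceFailure (Arrival (extend x) c) L T 0 0 ≤ B) :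
    expect (slotWeights r q T M)
      (fun x => if A x ∧ ∀ t < T, ¬ Hit u (extend x) c (L - 1) t then 1 else 0) ≤ B := by
  obtain ⟨m, hm⟩ := Function.ne_iff.1 hu
  have hm' : ∃ h : (m : ℕ) < α, u ⟨m, h⟩ ≠ 0 := ⟨m.2, hm⟩
  have hW : ∀ y (s : FinSlot M q), 0 ≤ slotWeights r q T M y s :=
    fun y s => slotWeight_nonneg (h0 _) (h1 _) s
  set g : FinOutcome L q T M → ℝ := fun x =>
    (∏ y, slotWeights r q T M y (x y)) * if A x then 1 else 0 with hg
  have hginv : ∀ x x', SameSchedule x x' → g x = g x' := by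
    intro x x' hS
    simp only [hg, hA x x' hS]
    congr 1
    refine Finset.prod_congr rfl fun y _ => ?_
    simp only [slotWeights, slotWeight, (hS y).1]
  have key := sum_mul_raceFailure (c := c) hαM hTM hm' hginv le_rfl
  calc _ ≤ ∑ x, g x * raceFailure (Arrival (extend x) c) L (T - T)
        (frontier u (extend x) c m T).1 T := by
        refine Finset.sum_le_sum fun x _ => ?_
        rw [hg, mul_assoc]
        refine mul_le_mul_of_nonneg_left ?_ (Finset.prod_nonneg fun y _ => hW _ _)
        beta_reduce
        by_cases h : A x
        · rw [if_pos h, one_mul]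
          split_ifs with h'
          -- Without a hit on the last link the frontier is short of the sink at time `T`, where the
          -- race with no slots left has failure probability 1.
          · rw [Nat.sub_self, raceFailure, if_pos (frontier_fst_lt hL h'.2)]
          · exact raceFailure_nonneg _ _ _
        · rw [if_neg h, if_neg fun h' => h h'.1, zero_mul]
    _ = _ := key
    _ ≤ expect (slotWeights r q T M) (fun _ => B) := by
        refine Finset.sum_le_sum fun x _ => ?_
        rw [hg, mul_assoc]
        refine mul_le_mul_of_nonneg_left ?_ (Finset.prod_nonneg fun y _ => hW _ _)
        split_ifs with h
        · rw [one_mul]; exact hB x h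
        · rw [zero_mul]; exact hB0
    _ = B := expect_const (fun i => sum_slotWeight _) B

-- Off the good event `A` the probability is paid in full. On `A`, an undecodable chunk has a
-- nonzero witness `u`, and there are at most `2 ^ α` of them.
open Classical in
theorem expect_undecodable_le (hL : 0 < L) (h0 : ∀ i, 0 ≤ r i) (h1 : ∀ i, r i ≤ 1)
    (hαM : α ≤ M) (hTM : T ≤ M) {A : FinOutcome L q T M → Prop}
    (hA : ∀ x x', SameSchedule x x' → (A x ↔ A x')) {B : ℝ} (hB0 : 0 ≤ B)
    (hB : ∀ x, A x → raceFailure (Arrival (extend x) c) L T 0 0 ≤ B) :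
    expect (slotWeights r q T M) (fun x => if ¬ ChunkDecodable α (extend x) T c then 1 else 0)
      ≤ expect (slotWeights r q T M) (fun x => if ¬ A x then 1 else 0) + 2 ^ α * B := by
  have hW : ∀ y (s : FinSlot M q), 0 ≤ slotWeights r q T M y s :=
    fun y s => slotWeight_nonneg (h0 _) (h1 _) s
  calc _ ≤ expect (slotWeights r q T M) (fun x => (if ¬ A x then 1 else 0)
        + ∑ u ∈ Finset.univ.filter (fun u : Fin α → ZMod 2 => u ≠ 0),
          if A x ∧ ∀ t < T, ¬ Hit u (extend x) c (L - 1) t then (1 : ℝ) else 0) := by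
        refine expect_mono hW fun x => ?_
        have hs : ∀ u : Fin α → ZMod 2, (0 : ℝ) ≤
            if A x ∧ ∀ t < T, ¬ Hit u (extend x) c (L - 1) t then (1 : ℝ) else 0 := by
          intro u; split_ifs <;> norm_num
        by_cases hAx : A x
        · rw [if_neg (not_not.2 hAx), zero_add]
          by_cases hd : ChunkDecodable α (extend x) T c
          · rw [if_neg (not_not.2 hd)]
            exact Finset.sum_nonneg fun u _ => hs u
          · obtain ⟨u, hu, hhit⟩ := exists_forall_not_hit hL hd
            rw [if_pos hd]
            refine le_trans ?_ (Finset.single_le_sum (fun u _ => hs u)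
              (Finset.mem_filter.2 ⟨Finset.mem_univ u, hu⟩))
            rw [if_pos ⟨hAx, hhit⟩]
        · rw [if_pos hAx]
          have := Finset.sum_nonneg (s := Finset.univ.filter fun u : Fin α → ZMod 2 => u ≠ 0)
            fun u _ => hs u
          have h2 : (if ¬ ChunkDecodable α (extend x) T c then (1 : ℝ) else 0) ≤ 1 := by
            split_ifs <;> norm_num
          linarith
    _ = expect (slotWeights r q T M) (fun x => if ¬ A x then 1 else 0)
        + ∑ u ∈ Finset.univ.filter (fun u : Fin α → ZMod 2 => u ≠ 0),
          expect (slotWeights r q T M) (fun x =>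
            if A x ∧ ∀ t < T, ¬ Hit u (extend x) c (L - 1) t then (1 : ℝ) else 0) := by
        rw [expect_add, expect_sum]
    _ ≤ expect (slotWeights r q T M) (fun x => if ¬ A x then 1 else 0)
        + ∑ u ∈ Finset.univ.filter (fun u : Fin α → ZMod 2 => u ≠ 0), B := by
        gcongr with u hu
        exact expect_forall_not_hit_le hL h0 h1 hαM hTM (Finset.mem_filter.1 hu).2 hA hB0 hB
    _ ≤ _ := by
        rw [Finset.sum_const, nsmul_eq_mul]
        gcongr
        have : (Finset.univ.filter fun u : Fin α → ZMod 2 => u ≠ 0).card ≤ 2 ^ α :=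
          (Finset.card_filter_le _ _).trans_eq (by simp [ZMod.card])
        exact_mod_cast this

end Flip

/-! ### Lower tails for the numbers of arrivals in windows. -/

section Chernoff

variable {L q T M α : ℕ} [NeZero q]

theorem exp_neg_le_one_sub {l : ℝ} (hl : 0 ≤ l) : Real.exp (-l) ≤ 1 - (l - l ^ 2) := by
  have h1 : l + 1 ≤ Real.exp l := Real.add_one_le_exp l
  have h2 : Real.exp (-l) ≤ 1 / (l + 1) := by
    rw [Real.exp_neg, ← one_div]
    exact one_div_le_one_div_of_le (by linarith) h1
  refine h2.trans ?_
  rw [div_le_iff₀ (by linarith)]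
  nlinarith [pow_nonneg hl 3]

open Classical in
/-- The number of packets of chunk `c` that arrive over link `i` in the slots `t₀, …, t₀ + b - 1`. -/
def arrivalCount (x : FinOutcome L q T M) (c : Fin q) (i t₀ b : ℕ) : ℕ :=
  ((Finset.Ico t₀ (t₀ + b)).filter (Arrival (extend x) c i)).card

theorem SameSchedule.arrivalCount_eq {x x' : FinOutcome L q T M} (h : SameSchedule x x')
    (c : Fin q) (i t₀ b : ℕ) : arrivalCount x c i t₀ b = arrivalCount x' c i t₀ b := by
  unfold arrivalCount
  congr 1
  ext t
  simp only [Finset.mem_filter, h.arrival_eq]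

-- Writes the generating function as a product over single transmissions, so that its expectation
-- factorizes.
open Classical in
theorem pow_arrivalCount_eq_prod (e : ℝ) (x : FinOutcome L q T M) (c : Fin q) (i : Fin L)
    {t₀ b : ℕ} (hb : t₀ + b ≤ T) :
    e ^ arrivalCount x c i t₀ b = ∏ y : Fin L × Fin T,
      if (y.1 = i ∧ (y.2 : ℕ) ∈ Finset.Ico t₀ (t₀ + b)) ∧ ((x y).1 = true ∧ (x y).2.1 = c)
        then e else 1 := by
  rw [Finset.prod_ite, Finset.prod_const_one, mul_one, Finset.prod_const]
  congr 1
  refine Finset.card_bij' (fun t ht => (i, ⟨t, ?_⟩)) (fun y _ => (y.2 : ℕ)) ?_ ?_ ?_ ?_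
  · have := Finset.mem_Ico.1 (Finset.mem_filter.1 ht).1
    omega
  · intro t ht
    obtain ⟨h1, hi, h2, h3⟩ := Finset.mem_filter.1 ht
    have htT : t < T := by have := Finset.mem_Ico.1 h1; omega
    simp only [success, chunk, extend, htT, dif_pos] at h2 h3
    exact Finset.mem_filter.2 ⟨Finset.mem_univ _, ⟨rfl, h1⟩, h2, h3⟩
  · rintro ⟨j, t⟩ hy
    obtain ⟨-, ⟨rfl, h1⟩, h2, h3⟩ := Finset.mem_filter.1 hy
    refine Finset.mem_filter.2 ⟨h1, j.2, ?_, ?_⟩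
    · simpa only [success, extend, t.2, dif_pos] using h2
    · simpa only [chunk, extend, t.2, dif_pos] using h3
  · intro t ht; rfl
  · rintro ⟨j, t⟩ hy
    obtain ⟨-, ⟨rfl, h1⟩, h2, h3⟩ := Finset.mem_filter.1 hy
    rfl

variable {r : Fin L → ℝ}

theorem expect_pow_arrivalCount (e : ℝ) (c : Fin q) (i : Fin L) {t₀ b : ℕ} (hb : t₀ + b ≤ T) :
    expect (slotWeights r q T M) (fun x => e ^ arrivalCount x c i t₀ b)
      = (1 - r i / q * (1 - e)) ^ b := by
  classical
  have hq : (q : ℝ) ≠ 0 := Nat.cast_ne_zero.2 (NeZero.ne q)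
  simp only [pow_arrivalCount_eq_prod e _ c i hb]
  rw [expect_prod (slotWeights r q T M) (fun y s => if (y.1 = i ∧ (y.2 : ℕ) ∈
    Finset.Ico t₀ (t₀ + b)) ∧ (s.1 = true ∧ s.2.1 = c) then e else 1)]
  have hterm : ∀ y : Fin L × Fin T, (∑ s, slotWeights r q T M y s *
      if (y.1 = i ∧ (y.2 : ℕ) ∈ Finset.Ico t₀ (t₀ + b)) ∧ (s.1 = true ∧ s.2.1 = c) then e else 1)
      = if y.1 = i ∧ (y.2 : ℕ) ∈ Finset.Ico t₀ (t₀ + b) then 1 - r i / q * (1 - e) else 1 := by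
    intro y
    by_cases hy : y.1 = i ∧ (y.2 : ℕ) ∈ Finset.Ico t₀ (t₀ + b)
    · simp only [hy, true_and, and_self, if_true, slotWeights]
      rw [sum_slotWeight_mul (r i) (fun b c' => if b = true ∧ c' = c then e else 1)]
      have hs : ∑ c' : Fin q, (if c' = c then e else 1) = (q : ℝ) - (1 - e) := by
        rw [← Finset.add_sum_erase _ _ (Finset.mem_univ c), if_pos rfl,
          Finset.sum_congr rfl fun c' hc' => if_neg (Finset.ne_of_mem_erase hc'),
          Finset.sum_const, Finset.card_erase_of_mem (Finset.mem_univ c), Finset.card_univ,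
          Fintype.card_fin, nsmul_eq_mul, Nat.cast_sub (NeZero.pos q)]
        push_cast; ring
      simp only [true_and, hs, Bool.false_eq_true, false_and, if_false, Finset.sum_const,
        Finset.card_univ, Fintype.card_fin, nsmul_eq_mul]
      field_simp
      ring
    · simp only [hy, false_and, if_false, mul_one, slotWeights, sum_slotWeight]
  rw [Finset.prod_congr rfl fun y _ => hterm y, Finset.prod_ite, Finset.prod_const_one, mul_one,
    Finset.prod_const]
  congr 1
  have : (Finset.Ico t₀ (t₀ + b)).card = b := by simp
  conv_rhs => rw [← this]
  symm
  refine Finset.card_bij' (fun t ht => (i, ⟨t, ?_⟩)) (fun y _ => (y.2 : ℕ)) ?_ ?_ ?_ ?_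
  · have := Finset.mem_Ico.1 ht
    omega
  · intro t ht
    exact Finset.mem_filter.2 ⟨Finset.mem_univ _, rfl, ht⟩
  · rintro ⟨j, t⟩ hy
    exact (Finset.mem_filter.1 hy).2.2
  · intro t ht; rfl
  · rintro ⟨j, t⟩ hy
    obtain ⟨-, rfl, h1⟩ := Finset.mem_filter.1 hy
    rfl

open Classical in
/-- Chernoff's bound for the lower tail of the number of arrivals. -/
theorem expect_arrivalCount_lt_le (h0 : ∀ i, 0 ≤ r i) (h1 : ∀ i, r i ≤ 1) (c : Fin q) (i : Fin L)
    {t₀ b : ℕ} (hb : t₀ + b ≤ T) {l ν μ : ℝ} (hl0 : 0 ≤ l) (hl1 : l ≤ 1)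
    (hμ : μ ≤ b * (r i / q)) :
    expect (slotWeights r q T M) (fun x => if (arrivalCount x c i t₀ b : ℝ) < ν then 1 else 0)
      ≤ Real.exp (l * ν - μ * (l - l ^ 2)) := by
  have hq1 : (1 : ℝ) ≤ q := by exact_mod_cast NeZero.pos q
  have hρ0 : 0 ≤ r i / q := div_nonneg (h0 i) (by linarith)
  have hρ1 : r i / q ≤ 1 := (div_le_one (by linarith)).2 ((h1 i).trans hq1)
  have he := exp_neg_le_one_sub hl0
  have he0 := Real.exp_pos (-l)
  calc _ ≤ expect (slotWeights r q T M) (fun x =>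
        Real.exp (l * ν) * Real.exp (-l) ^ arrivalCount x c i t₀ b) := by
        refine expect_mono (fun y s => slotWeight_nonneg (h0 _) (h1 _) s) fun x => ?_
        rw [← Real.exp_nat_mul, ← Real.exp_add]
        split_ifs with h
        · apply Real.one_le_exp
          nlinarith
        · positivity
    _ = Real.exp (l * ν) * (1 - r i / q * (1 - Real.exp (-l))) ^ b := by
        rw [expect_const_mul, expect_pow_arrivalCount _ c i hb]
    _ ≤ Real.exp (l * ν) * Real.exp (-(r i / q * (1 - Real.exp (-l)))) ^ b := by
        have hle : Real.exp (-l) ≤ 1 := Real.exp_le_one_iff.2 (by linarith)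
        have hnn : 0 ≤ 1 - r i / q * (1 - Real.exp (-l)) := by nlinarith
        gcongr
        exact Real.one_sub_le_exp_neg _
    _ ≤ _ := by
        rw [← Real.exp_nat_mul, ← Real.exp_add]
        apply Real.exp_le_exp.2
        have h2 : l - l ^ 2 ≤ 1 - Real.exp (-l) := by linarith
        have h3 : 0 ≤ l - l ^ 2 := by nlinarith
        have h4 : μ * (l - l ^ 2) ≤ b * (r i / q) * (1 - Real.exp (-l)) :=
          (mul_le_mul_of_nonneg_right hμ h3).trans
            (mul_le_mul_of_nonneg_left h2 (by positivity))
        linarith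

open Classical in
/-- Chunk failure probability in terms of `w` windows of `b` slots and a threshold `n` for the
number of arrivals in a window. -/
theorem expect_undecodable_le_of_windows (hL : 0 < L) (h0 : ∀ i, 0 ≤ r i) (h1 : ∀ i, r i ≤ 1)
    (hαM : α ≤ M) (hTM : T ≤ M) (c : Fin q) {w b n : ℕ} (hwb : w * b ≤ T)
    {l ν μ : ℝ} (hl0 : 0 ≤ l) (hl1 : l ≤ 1) (hν : (n : ℝ) - 1 < ν) (hμ : ∀ i, μ ≤ b * (r i / q)) :
    expect (slotWeights r q T M) (fun x => if ¬ ChunkDecodable α (extend x) T c then 1 else 0)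
      ≤ w * L * Real.exp (l * ν - μ * (l - l ^ 2))
        + 2 ^ α * (2 ^ w * ((1 / 2) ^ n) ^ (w + 1 - L)) := by
  set A : FinOutcome L q T M → Prop := fun x =>
    ∀ j < w, ∀ i < L, n ≤ arrivalCount x c i (j * b) b with hAdef
  refine (expect_undecodable_le hL h0 h1 hαM hTM (A := A)
    (B := 2 ^ w * ((1 / 2) ^ n) ^ (w + 1 - L)) ?_ (by positivity) ?_).trans ?_
  · intro x x' hS
    simp only [hAdef, hS.arrivalCount_eq]
  · intro x hx
    have := raceFailure_windows_le (R := Arrival (extend x) c) (L := L) (θ := (1 / 2) ^ n)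
      (by positivity) (pow_le_one₀ (by norm_num) (by norm_num)) (b := b) (r := T - w * b) w
      (l := 0) (t := 0) (Nat.zero_le _) (fun j hj i hi => by
        rw [zero_add]
        exact pow_le_pow_of_le_one (by norm_num) (by norm_num) (hx j hj i hi))
    rwa [Nat.add_sub_cancel' hwb, Nat.sub_zero] at this
  · gcongr
    have hW : ∀ y (s : FinSlot M q), 0 ≤ slotWeights r q T M y s :=
      fun y s => slotWeight_nonneg (h0 _) (h1 _) s
    calc _ ≤ expect (slotWeights r q T M) (fun x => ∑ z : Fin w × Fin L,
          if (arrivalCount x c z.2 (z.1 * b) b : ℝ) < ν then (1 : ℝ) else 0) := by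
          refine expect_mono hW fun x => ?_
          have hs : ∀ z : Fin w × Fin L, (0 : ℝ) ≤
              if (arrivalCount x c z.2 (z.1 * b) b : ℝ) < ν then (1 : ℝ) else 0 := by
            intro z; split_ifs <;> norm_num
          by_cases hx : A x
          · rw [if_neg (not_not.2 hx)]
            exact Finset.sum_nonneg fun z _ => hs z
          · rw [if_pos hx]
            simp only [hAdef] at hx
            push Not at hx
            obtain ⟨j, hj, i, hi, hlt⟩ := hx
            refine le_trans ?_ (Finset.single_le_sum (fun z _ => hs z)
              (Finset.mem_univ (⟨j, hj⟩, ⟨i, hi⟩)))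
            rw [if_pos]
            refine lt_of_le_of_lt ?_ hν
            have : (arrivalCount x c i (j * b) b : ℝ) + 1 ≤ n := by exact_mod_cast hlt
            linarith
      _ ≤ ∑ z : Fin w × Fin L, Real.exp (l * ν - μ * (l - l ^ 2)) := by
          rw [expect_sum]
          refine Finset.sum_le_sum fun z _ => ?_
          refine expect_arrivalCount_lt_le h0 h1 c z.2 ?_ hl0 hl1 (hμ _)
          calc (z.1 : ℕ) * b + b = (z.1 + 1) * b := by ring
            _ ≤ w * b := Nat.mul_le_mul_right b z.1.2
            _ ≤ T := hwb
      _ = _ := by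
          rw [Finset.sum_const, Finset.card_univ, Fintype.card_prod, Fintype.card_fin,
            Fintype.card_fin, nsmul_eq_mul]
          push_cast
          ring

end Chernoff

/-! ### Choice of windows and the failure probability of one chunk. -/

section ChunkFailure

variable {L q T M α : ℕ} [NeZero q] {r : Fin L → ℝ}

theorem two_pow_mul_eq_exp (α n : ℕ) {w L : ℕ} (h : L ≤ w) :
    (2 : ℝ) ^ α * (2 ^ w * ((1 / 2) ^ n) ^ (w + 1 - L))
      = Real.exp (Real.log 2 * (α + w - n * (w + 1 - L))) := by
  have hcast : ((w + 1 - L : ℕ) : ℝ) = w + 1 - L := by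
    rw [Nat.cast_sub (by omega)]; push_cast; ring
  have h2 : ∀ j : ℕ, (2 : ℝ) ^ j = Real.exp (j * Real.log 2) := fun j => by
    rw [Real.exp_nat_mul, Real.exp_log two_pos]
  rw [one_div, inv_pow, inv_pow, ← pow_mul, h2, h2, h2, ← Real.exp_neg, ← Real.exp_add,
    ← Real.exp_add]
  congr 1
  push_cast [hcast]
  ring

open Classical in
/-- If each link delivers `(1 + γ) α` packets of a chunk on average and `α` is large, then the chunk
fails with probability at most `β`. -/
theorem expect_undecodable_le_of_large (hL : 2 ≤ L) (h0 : ∀ i, 0 ≤ r i) (h1 : ∀ i, r i ≤ 1)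
    (hαM : α ≤ M) (hTM : T ≤ M) (c : Fin q) {γ β : ℝ} (hγ : γ ∈ Set.Ioo (0 : ℝ) 1)
    (hβ : β ∈ Set.Ioo (0 : ℝ) 1) (hα : 9000 * (L / γ ^ 3 * Real.log (L / (β * γ))) ≤ α)
    (hT : ∀ i, (1 + γ) * α ≤ T * (r i / q)) :
    expect (slotWeights r q T M) (fun x => if ¬ ChunkDecodable α (extend x) T c then 1 else 0)
      ≤ β := by
  obtain ⟨hγ0, hγ1⟩ := hγ
  obtain ⟨hβ0, hβ1⟩ := hβ
  have hq1 : (1 : ℝ) ≤ q := by exact_mod_cast NeZero.pos q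
  have hL2 : (2 : ℝ) ≤ L := by exact_mod_cast hL
  set Y : ℝ := L / γ with hY
  have hYL : Y * γ = L := by rw [hY]; field_simp
  have hY2 : 2 ≤ Y := by nlinarith
  set Λ : ℝ := Real.log (L / (β * γ)) with hΛ
  have hβγ : 0 < β * γ := by positivity
  have hexpΛ : Real.exp (-Λ) = β * γ / L := by
    rw [hΛ, Real.exp_neg, Real.exp_log (by positivity), inv_div]
  have hexp_le : Real.exp (-Λ) ≤ 1 / 2 := by
    rw [hexpΛ, div_le_iff₀ (by linarith)]
    nlinarith
  have hΛ2 : 1 / 2 ≤ Λ := by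
    have := Real.add_one_le_exp (-Λ)
    linarith
  have hαY : 9000 * (Y * Λ) ≤ α * γ ^ 2 := by
    calc 9000 * (Y * Λ) = 9000 * (L / γ ^ 3 * Λ) * γ ^ 2 := by rw [hY]; field_simp
      _ ≤ _ := mul_le_mul_of_nonneg_right hα (by positivity)
  have hYΛ : Y / 2 ≤ Y * Λ := by nlinarith
  have hα0 : (0 : ℝ) ≤ α := Nat.cast_nonneg _
  have hαγ : α * γ ^ 2 ≤ α * γ := by nlinarith [mul_nonneg hα0 hγ0.le]
  -- With `w ≥ 8L/γ` windows, giving up `L` of them costs only a factor `1 - γ/8`.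
  set w : ℕ := ⌈8 * Y⌉₊ with hw
  have hw8 : 8 * Y ≤ w := Nat.le_ceil _
  have hw9 : (w : ℝ) ≤ 9 * Y := by
    have := Nat.ceil_lt_add_one (show 0 ≤ 8 * Y by linarith)
    linarith
  have hw0 : (0 : ℝ) < w := by linarith
  have hw0' : 0 < w := by exact_mod_cast hw0
  set b : ℕ := T / w with hb
  have hwb : w * b ≤ T := Nat.mul_div_le T w
  have hbT : (T : ℝ) ≤ w * (b + 1) := by
    have := (Nat.lt_mul_div_succ T hw0').le
    exact_mod_cast this
  set a : ℝ := α / w with ha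
  have haw : a * w = α := by rw [ha]; field_simp
  have ha0 : 0 ≤ a := by positivity
  -- Half of the surplus `γ` is left for Chernoff's bound, and the other half must beat the `2 ^ α`
  -- union bound.
  set ν : ℝ := (1 + γ / 2) * a with hν
  have hν0 : 0 ≤ ν := by positivity
  set n : ℕ := ⌈ν⌉₊ with hn
  have hn1 : (n : ℝ) - 1 < ν := by linarith [Nat.ceil_lt_add_one hν0]
  have hn2 : ν ≤ n := Nat.le_ceil _
  have haγ : 8 ≤ a * γ := by
    rw [ha, div_mul_eq_mul_div, le_div_iff₀ hw0]
    linarith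
  -- Rounding `T / w` down loses at most one expected arrival per window, and `1 ≤ a * γ / 8`.
  have hμ : ∀ i, (1 + 7 * γ / 8) * a ≤ b * (r i / q) := by
    intro i
    have hρ1 : r i / q ≤ 1 := (div_le_one (by linarith)).2 ((h1 i).trans hq1)
    have hρ0 : 0 ≤ r i / q := div_nonneg (h0 i) (by linarith)
    have e1 : (1 + γ) * α ≤ w * (b + 1) * (r i / q) :=
      (hT i).trans (mul_le_mul_of_nonneg_right hbT hρ0)
    rw [← haw] at e1
    have e2 : (1 + γ) * a ≤ (b + 1) * (r i / q) := by
      refine le_of_mul_le_mul_right ?_ hw0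
      linarith
    linarith
  refine (expect_undecodable_le_of_windows (by omega) h0 h1 hαM hTM c hwb (l := γ / 10)
    (by linarith) (by linarith) hn1 hμ).trans ?_
  have hΛa : 1000 * Λ ≤ a * γ ^ 2 := by
    rw [ha, div_mul_eq_mul_div, le_div_iff₀ hw0]
    have : Λ * w ≤ Λ * (9 * Y) := mul_le_mul_of_nonneg_left hw9 (by linarith)
    linarith
  have hexp2 : Real.exp (-(2 * Λ)) = (β * γ / L) ^ 2 := by
    rw [← hexpΛ, ← Real.exp_nat_mul]; congr 1; push_cast; ring
  have first : w * L * Real.exp (γ / 10 * ν - (1 + 7 * γ / 8) * a * (γ / 10 - (γ / 10) ^ 2))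
      ≤ β / 2 := by
    have e1 : γ / 10 * ν - (1 + 7 * γ / 8) * a * (γ / 10 - (γ / 10) ^ 2) ≤ -(10 * Λ) := by
      have : γ / 10 * ν - (1 + 7 * γ / 8) * a * (γ / 10 - (γ / 10) ^ 2)
          = a * γ ^ 2 * (-(11 / 400) + 7 * γ / 800) := by rw [hν]; ring
      rw [this]
      have : a * γ ^ 2 * (-(11 / 400) + 7 * γ / 800) ≤ a * γ ^ 2 * (-(1 / 100)) :=
        mul_le_mul_of_nonneg_left (by linarith) (by positivity)
      linarith
    have e2 : Real.exp (-(10 * Λ)) = (β * γ / L) ^ 2 * Real.exp (-Λ) ^ 8 := by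
      rw [← hexp2, ← Real.exp_nat_mul, ← Real.exp_add]; congr 1; push_cast; ring
    have e3 : Real.exp (-Λ) ^ 8 ≤ (1 / 2) ^ 8 := pow_le_pow_left₀ (Real.exp_pos _).le hexp_le 8
    calc _ ≤ 9 * Y * L * ((β * γ / L) ^ 2 * (1 / 2) ^ 8) := by
          refine mul_le_mul (mul_le_mul_of_nonneg_right hw9 (by linarith)) ?_ (Real.exp_pos _).le
            (by positivity)
          refine (Real.exp_le_exp.2 e1).trans ?_
          rw [e2]
          exact mul_le_mul_of_nonneg_left e3 (by positivity)
      _ = 9 / 256 * (β * (β * γ)) := by rw [hY]; field_simp; norm_num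
      _ ≤ 9 / 256 * (β * 1) := by
          gcongr
          exact mul_le_one₀ hβ1.le hγ0.le hγ1.le
      _ ≤ β / 2 := by linarith
  have second : (2 : ℝ) ^ α * (2 ^ w * ((1 / 2) ^ n) ^ (w + 1 - L)) ≤ β / 2 := by
    have hLw : (L : ℝ) ≤ w := by
      have := mul_le_mul_of_nonneg_left hγ1.le (show 0 ≤ Y by linarith)
      linarith
    have hLw' : L ≤ w := by exact_mod_cast hLw
    have hlog : 1 / 2 ≤ Real.log 2 := by linarith [Real.log_two_gt_d9]
    have e1 : (1 + γ / 4) * α ≤ n * (w + 1 - L) := by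
      have hwL : L ≤ w * (γ / 8) := by
        have := mul_le_mul_of_nonneg_right hw8 hγ0.le
        linarith
      have f1 : w * (1 - γ / 8) ≤ w + 1 - L := by linarith
      have f2 : 0 ≤ w * (1 - γ / 8) := by apply mul_nonneg hw0.le; linarith
      calc (1 + γ / 4) * α ≤ (1 + γ / 2) * (1 - γ / 8) * α := by
            apply mul_le_mul_of_nonneg_right _ hα0
            have := mul_le_mul_of_nonneg_left hγ1.le hγ0.le
            linarith
        _ = ν * (w * (1 - γ / 8)) := by rw [hν, ← haw]; ring
        _ ≤ n * (w + 1 - L) := mul_le_mul hn2 f1 f2 (by positivity)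
    have hΛY : 2 * Λ ≤ Y * Λ := mul_le_mul_of_nonneg_right hY2 (by linarith)
    -- The surplus `γ * α / 4 ≥ 2250 * (Y * Λ)` dominates `w ≤ 9 * Y ≤ 18 * (Y * Λ)`.
    have e2 : (α : ℝ) + w - n * (w + 1 - L) ≤ -(4 * Λ) := by linarith
    rw [two_pow_mul_eq_exp α n hLw']
    calc _ ≤ Real.exp (-(2 * Λ)) := by
          apply Real.exp_le_exp.2
          have := mul_le_mul_of_nonneg_left e2 (show 0 ≤ Real.log 2 by linarith)
          have := mul_le_mul_of_nonneg_right hlog (show 0 ≤ 4 * Λ by linarith)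
          linarith
      _ = (β * γ / L) ^ 2 := hexp2
      _ ≤ (β / 2) ^ 2 := by
          refine pow_le_pow_left₀ (by positivity) ?_ 2
          exact div_le_div₀ hβ0.le (mul_le_of_le_one_right hβ0.le hγ1.le) two_pos hL2
      _ ≤ β / 2 := by
          have := mul_le_mul_of_nonneg_left hβ1.le hβ0.le
          linarith
  linarith

end ChunkFailure

/-! ### Tail of the coding delay at a fixed message length. -/

section Delay

variable {L q α : ℕ} [NeZero q]

theorem LineNetwork.minP_le (N : LineNetwork L) (i : Fin L) : N.minP ≤ N.p i :=
  ciInf_le (Set.finite_range _).bddBelow i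

theorem LineNetwork.minP_pos (hL : 0 < L) (N : LineNetwork L) : 0 < N.minP := by
  have : Nonempty (Fin L) := ⟨⟨0, hL⟩⟩
  obtain ⟨i, hi⟩ := exists_eq_ciInf_of_finite (f := N.p)
  rw [LineNetwork.minP, ← hi]
  exact N.p_pos i

/-- A bound for the tail of the coding delay at a fixed message length. -/
theorem law_lt_codingDelay_le (hL : 2 ≤ L) (N : LineNetwork L) {k : ℕ} {F : Type*}
    {encode : (Fin k → F) → (Fin q × Fin α → F)} {a β γ τ : ℝ} (ha : 0 ≤ a)
    (hβ : β ∈ Set.Ioo (0 : ℝ) 1) (hγ : γ ∈ Set.Ioo (0 : ℝ) 1)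
    (he : CorrectsErasures encode ((1 + a) * β)) (hτ : 1 ≤ τ)
    (hα : 9000 * (L / γ ^ 3 * Real.log (L / (β * γ))) ≤ α)
    (hT : (1 + γ) * (α * q) ≤ (τ - 1) * N.minP) :
    law N q {ω | ENNReal.ofReal τ < codingDelay encode ω}
      ≤ ENNReal.ofReal (Real.exp (-((a * β * q) ^ 2 / (8 * L * τ)))) := by
  classical
  set T := ⌊τ⌋₊ with hTdef
  -- Enough coefficients both for the source, which uses `α`, and for the relays, which index them
  -- by slots.
  set M := max α T with hM
  have hαM : α ≤ M := le_max_left _ _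
  have hTM : T ≤ M := le_max_right _ _
  have hτ0 : 0 ≤ τ := by linarith
  have hT1 : 1 ≤ T := Nat.one_le_floor_iff _ |>.2 hτ
  have hTτ : (T : ℝ) ≤ τ := Nat.floor_le hτ0
  have hτT : τ - 1 ≤ T := by linarith [Nat.lt_floor_add_one τ]
  have hq : (0 : ℝ) < q := by exact_mod_cast NeZero.pos q
  have hp0 := N.minP_pos (by omega)
  have hT' : ∀ i, (1 + γ) * α ≤ T * (N.p i / q) := by
    intro i
    rw [← mul_div_assoc, le_div_iff₀ hq, mul_assoc]
    exact hT.trans (mul_le_mul hτT (N.minP_le i) hp0.le (Nat.cast_nonneg _))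
  set P := slotWeights N.p q T M with hP
  have hP0 : ∀ y s, 0 ≤ P y s := fun y s => slotWeight_nonneg (N.p_pos _).le (N.p_le_one _) s
  have hP1 : ∀ y, ∑ s, P y s = 1 := fun y => sum_slotWeight _
  set f : FinOutcome L q T M → ℝ := fun x => undecodableCount α (extend x) T with hf
  have hmean : expect P f ≤ β * q := by
    have hcount : f = fun x => ∑ c, if ¬ ChunkDecodable α (extend x) T c then (1 : ℝ) else 0 := by
      funext x
      simp only [hf, undecodableCount, Finset.card_filter, Nat.cast_sum, Nat.cast_ite, Nat.cast_one,
        Nat.cast_zero]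
    rw [hcount, expect_sum]
    refine (Finset.sum_le_sum fun c _ => expect_undecodable_le_of_large hL
      (fun i => (N.p_pos i).le) N.p_le_one hαM hTM c hγ hβ hα hT').trans_eq ?_
    rw [Finset.sum_const, Finset.card_univ, Fintype.card_fin, nsmul_eq_mul, mul_comm]
  have hcard : (Fintype.card (Fin L × Fin T) : ℝ) = L * T := by simp
  have hL0 : (0 : ℝ) < L := by exact_mod_cast (by omega : 0 < L)
  have hT0 : (0 : ℝ) < T := by exact_mod_cast hT1
  have hd : 0 ≤ a * β * q := mul_nonneg (mul_nonneg ha hβ.1.le) hq.le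
  -- There are `L * T` independent transmissions and differences at most 2, whence `2 * (L * T * 2²)
  -- = 8 * L * T` in the exponent.
  have hmd := expect_indicator_ge_le hP0 hP1 (c := 2)
    (fun x y s => abs_undecodableCount_sub_update_le hαM hTM x y s) hmean hd
    (by rw [hcard]; positivity)
  calc _ ≤ law N q {ω | truncate T M ω ∈ {x | β * q + a * β * q ≤ f x}} := by
        refine measure_mono fun ω hω => ?_
        have := undecodableCount_of_lt_codingDelay he hτ0 hω
        simp only [Set.mem_ofPred_eq, hf, undecodableCount_extend_truncate hαM hTM]
        linarith
    _ ≤ _ := law_le_expect N _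
    _ ≤ _ := by
        refine ENNReal.ofReal_le_ofReal (le_trans (le_of_eq ?_) (hmd.trans ?_))
        · congr!
        · rw [hcard]
          apply Real.exp_le_exp.2
          apply neg_le_neg
          apply div_le_div_of_nonneg_left (sq_nonneg _) (by positivity)
          nlinarith

end Delay

end ChunkedCode

end

/-! ### The asymptotic statement: constants and rate of the precode. -/

theorem mainTheorem11 :
    ∃ C : ℝ, 0 < C ∧ ∀ δ₀ : ℝ, 0 < δ₀ → δ₀ < 1 → ∃ K : ℝ, 0 < K ∧
      ∀ (L : ℕ) (_ : 2 ≤ L) (N : ChunkedCode.LineNetwork L) (_ : Function.Injective N.p)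
        (γa γb γc : ℝ) (_ : γa ∈ Set.Ioo (0 : ℝ) 1) (_ : γb ∈ Set.Ioo (0 : ℝ) 1)
        (_ : γc ∈ Set.Ioo (0 : ℝ) 1) (_ : (1 + γa) * γb ≤ δ₀)
        (k q α : ℕ → ℕ) (ε : ℕ → ℝ)
        (F : ℕ → Type*) [∀ n, AddCommGroup (F n)] [∀ n, Module (ZMod 2) (F n)]
        (encode : ∀ n, (Fin (k n) → F n) → (Fin (q n) × Fin (α n) → F n)),
        (∀ n, 0 < q n) →
        (∀ n, ε n ∈ Set.Ioo (0 : ℝ) 1) →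
        Tendsto k atTop atTop →
        Tendsto (fun n => (k n : ℝ) / ((q n : ℝ) * α n)) atTop (𝓝 (1 - (1 + γa) * γb)) →
        (∀ n, ChunkedCode.CorrectsErasures (encode n) ((1 + γa) * γb)) →
        (∀ᶠ n in atTop,
          C * max ((L : ℝ) / γc ^ 3 * Real.log (L / (γb * γc)))
              ((L : ℝ) / N.minGap ^ 3 * Real.log (L / (N.minGap * γb))) ≤ (α n : ℝ)) →
        (fun n => (α n : ℝ) ^ 2 / (γa ^ 2 * γb ^ 2)) =o[atTop]
          (fun n => (k n : ℝ) / Real.log (1 / ε n)) →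
        ∀ᶠ n in atTop,
          ChunkedCode.law N (q n)
              {ω | ENNReal.ofReal
                    ((1 + γc) * (1 + (1 + γa) * γb + K * γb ^ 2) * ((k n : ℝ) / N.minP)) <
                  ChunkedCode.codingDelay (encode n) ω}
            ≤ ENNReal.ofReal (ε n) := by
  refine ⟨9000, by norm_num, fun δ₀ hδ₀ hδ₁ => ⟨5 / (1 - δ₀), div_pos (by norm_num) (by linarith),
    ?_⟩⟩
  intro L hL N _ γa γb γc hγa hγb hγc hδ k q α ε F _ _ encode hq hε hk hrate henc hα ho
  obtain ⟨ha0, ha1⟩ := hγa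
  have hb := hγb
  obtain ⟨hb0, hb1⟩ := hb
  have hc := hγc
  obtain ⟨hc0, hc1⟩ := hc
  set δ := (1 + γa) * γb with hδdef
  set K := 5 / (1 - δ₀) with hK
  set p := N.minP with hp
  have hp0 : 0 < p := N.minP_pos (by omega)
  have hp1 : p ≤ 1 := (N.minP_le ⟨0, by omega⟩).trans (N.p_le_one _)
  have hL0 : (0 : ℝ) < L := by exact_mod_cast (by omega : 0 < L)
  have hδpos : 0 < δ := by positivity
  have hδ2 : δ ≤ 2 * γb := by
    rw [hδdef]
    exact mul_le_mul_of_nonneg_right (by linarith) hb0.le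
  have hK0 : 0 < K := div_pos (by norm_num) (by linarith)
  set G := 1 + δ + K * γb ^ 2 with hG
  have hG0 : 0 < G := by positivity
  -- `(1 - δ) * (1 + δ) = 1 - δ²` loses at most `4 * γb²`, since `δ ≤ 2 * γb`. The choice `K = 5 /
  -- (1 - δ₀)` returns at least `5 * γb²`. Half of the remaining `γb²` absorbs the convergence of
  -- the rate, the other half the rounding of the delay to whole slots.
  have hGδ : 1 + γb ^ 2 ≤ (1 - δ) * G := by
    have h1 : K * (1 - δ₀) = 5 := div_mul_cancel₀ _ (by linarith)
    have h2 : 5 ≤ K * (1 - δ) := by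
      rw [← h1]; exact mul_le_mul_of_nonneg_left (by linarith) hK0.le
    have h3 : 5 * γb ^ 2 ≤ K * (1 - δ) * γb ^ 2 := mul_le_mul_of_nonneg_right h2 (sq_nonneg _)
    have h4 : δ ^ 2 ≤ (2 * γb) ^ 2 := pow_le_pow_left₀ hδpos.le hδ2 2
    have h5 : (1 - δ) * G = 1 - δ ^ 2 + K * (1 - δ) * γb ^ 2 := by rw [hG]; ring
    rw [h5]
    linarith
  have hρ : (1 + γb ^ 2 / 2) / G < 1 - δ := by
    rw [div_lt_iff₀ hG0]
    have : 0 < γb ^ 2 := by positivity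
    linarith
  set B := (1 + γc) * G / p with hB
  have hB0 : 0 < B := by positivity
  have hkR : Tendsto (fun n => (k n : ℝ)) atTop atTop := tendsto_natCast_atTop_atTop.comp hk
  filter_upwards [hα, hrate.eventually (lt_mem_nhds hρ),
    hrate.eventually (gt_mem_nhds (show 1 - δ < 1 by linarith)),
    hkR.eventually_ge_atTop (2 / γb ^ 2), hkR.eventually_ge_atTop 1,
    hkR.eventually_ge_atTop (1 / B),
    ho.def (show 0 < 1 / (8 * L * B) by positivity)] with n hαn hlow hup hk2 hk1 hkB hon
  have : NeZero (q n) := ⟨(hq n).ne'⟩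
  have hqn : (0 : ℝ) < q n := by exact_mod_cast hq n
  have hρ0 : 0 < (1 + γb ^ 2 / 2) / G := by positivity
  -- If `α n = 0` the rate is `0` by the convention for division by zero, contradicting its positive
  -- lower bound.
  have hαpos : (0 : ℝ) < α n := by
    rcases (Nat.cast_nonneg (α n) : (0 : ℝ) ≤ α n).eq_or_lt with h | h
    · rw [← h, mul_zero, div_zero] at hlow
      exact absurd (hρ0.trans hlow) (lt_irrefl _)
    · exact h
  have hqα : 0 < (q n : ℝ) * α n := by positivity
  have hkq : (k n : ℝ) ≤ q n * α n := by
    rw [div_lt_one hqα] at hup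
    exact hup.le
  have hlow' : (1 + γb ^ 2 / 2) * (q n * α n) ≤ G * k n := by
    rw [div_lt_div_iff₀ hG0 hqα] at hlow
    linarith
  have hτ : (1 + γc) * G * ((k n : ℝ) / p) = B * k n := by rw [hB]; ring
  have hτp : B * k n * p = (1 + γc) * (G * k n) := by rw [hB]; field_simp
  rw [hτ]
  have hτ1 : 1 ≤ B * k n := by
    rw [div_le_iff₀ hB0] at hkB
    linarith
  refine (ChunkedCode.law_lt_codingDelay_le hL N ha0.le hγb hγc (henc n) hτ1 ?_ ?_).trans ?_
  · exact (mul_le_mul_of_nonneg_left (le_max_left _ _) (by norm_num)).trans hαn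
  · have h1 : 1 ≤ γb ^ 2 / 2 * (q n * α n) := by
      rw [div_le_iff₀ (by positivity)] at hk2
      have := mul_le_mul_of_nonneg_left hkq (show 0 ≤ γb ^ 2 by positivity)
      linarith
    have h2 : (1 + γc) * ((1 + γb ^ 2 / 2) * (q n * α n)) ≤ (1 + γc) * (G * k n) :=
      mul_le_mul_of_nonneg_left hlow' (by linarith)
    have h3 : (1 + γc) * 1 ≤ (1 + γc) * (γb ^ 2 / 2 * (q n * α n)) :=
      mul_le_mul_of_nonneg_left h1 (by linarith)
    linarith
  · obtain ⟨hε0, hε1⟩ := hε n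
    have hlog : 0 < Real.log (1 / ε n) := Real.log_pos (by rw [one_div]; exact (one_lt_inv₀ hε0).2 hε1)
    apply ENNReal.ofReal_le_ofReal
    have key : Real.log (1 / ε n) ≤ (γa * γb * q n) ^ 2 / (8 * L * (B * k n)) := by
      rw [Real.norm_of_nonneg (by positivity), Real.norm_of_nonneg (by positivity)] at hon
      have hkpos : (0 : ℝ) < k n := by linarith
      rw [le_div_iff₀ (by positivity)]
      have h1 : Real.log (1 / ε n) * (8 * L * B) * (α n) ^ 2 ≤ k n * (γa * γb) ^ 2 := by
        rw [div_le_iff₀ (by positivity)] at hon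
        calc _ ≤ Real.log (1 / ε n) * (8 * L * B) * (1 / (8 * L * B) *
              ((k n : ℝ) / Real.log (1 / ε n)) * (γa ^ 2 * γb ^ 2)) :=
              mul_le_mul_of_nonneg_left hon (by positivity)
          _ = _ := by field_simp
      refine le_of_mul_le_mul_right ?_ (show 0 < (α n : ℝ) ^ 2 by positivity)
      calc _ = Real.log (1 / ε n) * (8 * L * B) * (α n) ^ 2 * k n := by ring
        _ ≤ k n * (γa * γb) ^ 2 * k n := mul_le_mul_of_nonneg_right h1 hkpos.le
        _ = (γa * γb) ^ 2 * (k n : ℝ) ^ 2 := by ring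
        -- The rate is eventually below 1, so `k ≤ q * α`; this is how `q` is bounded below by `k /
        -- α`.
        _ ≤ (γa * γb) ^ 2 * (q n * α n) ^ 2 := by gcongr
        _ = _ := by ring
    calc _ ≤ Real.exp (-Real.log (1 / ε n)) := Real.exp_le_exp.2 (neg_le_neg key)
      _ = ε n := by rw [one_div, Real.log_inv, neg_neg, Real.exp_log hε0]
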